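/- Let $N\ge 3$ be an integer and $\frac{2}{N-2}<\alpha<\frac{4}{N-2}$. There exists a two-parameter family of radially symmetric, sign-changing functions $U\in C^2(\mathbb R^N\setminus\{0\})\cap L^{\alpha+1}_{\mathrm{loc}}(\mathbb R^N)$ which are singular at $x=0$ (that is, $|U(x)|\to\infty$ as $x\to 0$) and which are stationary solutions of the nonlinear heat equation $\partial_t u=\Delta u+|u|^\alpha u$ in the sense of distributions, that is, $$\int_{\mathbb R^N}\bigl(U\,\Delta\varphi+|U|^\alpha U\,\varphi\bigr)\,dx=0\qquad\text{for all }\varphi\in C_c^\infty(\mathbb R^N).$$ Each of these solutions satisfies $|U(x)|\le C|x|^{-(N-2-\frac2\alpha)}$ for $|x|>1$, for some constant $C$ (depending on $U$), and oscillates indefinitely as $|x|\to\infty$: for every $R>0$, $U$ takes both positive and negative values on $\{|x|>R\}$. Here a two-parameter family means a family $(U_p)_{p\in P}$ indexed by the open rectangle $P=(0,\infty)\times\bigl(0,(\tfrac{\alpha+2}{2})^{1/\alpha}\bigr)\subset\mathbb R^2$ such that $U_p\ne U_q$ on $\mathbb R^N\setminus\{0\}$ whenever $p\ne q$, and such that $(p,x)\mapsto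 U_p(x)$ is continuous on $P\times(\mathbb R^N\setminus\{0\})$. -/

import Mathlib

open MeasureTheory Filter Topology
open scoped ContDiff Laplacian

namespace NLHE

/-- `U` is a stationary solution of the nonlinear heat equation `∂ₜ u = Δ u + |u|^α u` on `ℝ^N` in
the sense of distributions, i.e. `-Δ U = |U|^α U` in `𝓓'(ℝ^N)`: both `U` and `|U|^α U` are locally
integrable (so that they are distributions), and `∫ (U Δφ + |U|^α U φ) = 0` for every test
function `φ ∈ C_c^∞(ℝ^N)`. -/
def IsStationarySolution {N : ℕ} (α : ℝ) (U : EuclideanSpace ℝ (Fin N) → ℝ) : Prop :=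
  LocallyIntegrable U volume ∧
  LocallyIntegrable (fun x => |U x| ^ α * U x) volume ∧
  ∀ φ : EuclideanSpace ℝ (Fin N) → ℝ, ContDiff ℝ ∞ φ → HasCompactSupport φ →
    ∫ x, (U x * Δ φ x + |U x| ^ α * U x * φ x) = 0

/-- `U ∈ L^q_loc(ℝ^N)` (for `1 ≤ q < ∞`): `U` is in `L^q(K)` for every compact `K`. -/
def MemLqLoc {N : ℕ} (q : ℝ) (U : EuclideanSpace ℝ (Fin N) → ℝ) : Prop :=
  ∀ K : Set (EuclideanSpace ℝ (Fin N)), IsCompact K →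
    MemLp U (ENNReal.ofReal q) (volume.restrict K)

/-- `U` is radially symmetric on `ℝ^N ∖ {0}`. -/
def IsRadial {N : ℕ} (U : EuclideanSpace ℝ (Fin N) → ℝ) : Prop :=
  ∃ u : ℝ → ℝ, ∀ x, x ≠ 0 → U x = u ‖x‖

/-- `U` takes both positive and negative values on `ℝ^N ∖ {0}`. -/
def IsSignChanging {N : ℕ} (U : EuclideanSpace ℝ (Fin N) → ℝ) : Prop :=
  (∃ x, x ≠ 0 ∧ 0 < U x) ∧ ∃ x, x ≠ 0 ∧ U x < 0

/-- `U` is singular at the origin: `|U(x)| → ∞` as `x → 0`, `x ≠ 0`. -/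
def IsSingularAtZero {N : ℕ} (U : EuclideanSpace ℝ (Fin N) → ℝ) : Prop :=
  Tendsto (fun x => |U x|) (𝓝[≠] 0) atTop

/-- `U` oscillates indefinitely as `|x| → ∞`: it takes both positive and negative values outside
every ball (for a radial `U`, the profile changes sign at arbitrarily large radii). -/
def OscillatesAtInfinity {N : ℕ} (U : EuclideanSpace ℝ (Fin N) → ℝ) : Prop :=
  ∀ R : ℝ, (∃ x, R < ‖x‖ ∧ 0 < U x) ∧ ∃ x, R < ‖x‖ ∧ U x < 0

/-- The open rectangle `(0, ∞) × (0, ((α + 2) / 2)^(1/α))` of parameters in the plane. -/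
def parameterSet (α : ℝ) : Set (ℝ × ℝ) :=
  Set.Ioi 0 ×ˢ Set.Ioo 0 (((α + 2) / 2) ^ (1 / α))

end NLHE

/-! Put `θ = 2/α` and `U(x) = |x|^(-θ) w(log |x|)`. For `x ≠ 0` the equation becomes the autonomous
ODE `w'' - b w' - β w + |w|^α w = 0` with `b = 2θ - (N-2)` and `β = θ(N-2-θ)`. The upper bound on
`α` says `b > 0`, the lower one says `β > 0`. The energy `v²/2 - β w²/2 + |w|^(α+2)/(α+2)`, where `v
= w'`, has derivative `b v²` along orbits, so it increases, and its negative set consists of two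
wells separated by `w = 0`.

Backward in time, an orbit of negative energy with `w > 0` is trapped in the right-hand well
(`IsOrbit.exists_backward_bound`). So `w` stays between positive constants, and `U` blows up like
`|x|^(-θ)` at the origin. Since `θ(α+1) = θ + 2 < N`, both `U` and its nonlinearity are locally
integrable, and integration by parts leaves no mass at `0` (`integral_lineDeriv_eq_zero`,
`IsOrbit.isStationarySolution`).

Forward in time, once the energy is positive the orbit cannot settle on one side of `w = 0`
(`IsOrbit.exists_neg`, `IsOrbit.exists_pos`), while Grönwall applied to the shifted energy gives
`|w| ≤ C e^(bs)`, which is the required decay because `b - θ = -(N-2-θ)`.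

Initial data with both behaviours form an open set. It is nonempty because the orbit from `(A, 0)`,
with `A` the zero-energy amplitude, has positive energy at time `1`, and starting slightly to the
left of `A` makes the initial energy negative (`exists_ball_initial_data`). A ball of such data
supplies the two parameters; of the parameter rectangle only its inclusion in the open quadrant
matters. -/

namespace NLHE

open Set Metric

/-! ### Global flows of `C¹` vector fields with a Lyapunov function -/

section GlobalFlow

/-- A two-sided Grönwall inequality on a symmetric interval. -/
theorem le_mul_exp_of_abs_deriv_le {h h' : ℝ → ℝ} {c T : ℝ}
    (hd : ∀ t ∈ Icc (-T) T, HasDerivWithinAt h (h' t) (Icc (-T) T) t)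
    (hb : ∀ t ∈ Icc (-T) T, |h' t| ≤ c * h t) {t : ℝ} (ht : t ∈ Icc (-T) T) :
    h t ≤ h 0 * Real.exp (c * |t|) := by
  have hT : 0 ≤ T := by linarith [ht.1, ht.2]
  have h0 : (0 : ℝ) ∈ Icc (-T) T := ⟨by linarith, hT⟩
  have key : ∀ σ : ℝ, ∀ s ∈ Icc (-T) T, HasDerivWithinAt (fun s => h s * Real.exp (σ * s))
      ((h' s + σ * h s) * Real.exp (σ * s)) (Icc (-T) T) s := by
    intro σ s hs
    have h1 : HasDerivAt (fun s => Real.exp (σ * s)) (Real.exp (σ * s) * (σ * 1)) s :=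
      ((hasDerivAt_id s).const_mul σ).exp
    refine ((hd s hs).mul h1.hasDerivWithinAt).congr_deriv ?_
    ring
  rcases le_total 0 t with h1 | h1
  · have anti : AntitoneOn (fun s => h s * Real.exp (-c * s)) (Icc (-T) T) := by
      refine antitoneOn_of_hasDerivWithinAt_nonpos (convex_Icc _ _)
        (fun s hs => (key (-c) s hs).continuousWithinAt)
        (fun s hs => (key (-c) s (interior_subset hs)).mono interior_subset) ?_
      intro s hs
      have := (abs_le.1 (hb s (interior_subset hs))).2
      exact mul_nonpos_of_nonpos_of_nonneg (by linarith) (Real.exp_pos _).le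
    have h2 := anti h0 ht h1
    simp only [mul_zero, Real.exp_zero, mul_one] at h2
    rw [abs_of_nonneg h1]
    calc h t = h t * Real.exp (-c * t) * Real.exp (c * t) := by
          rw [mul_assoc, ← Real.exp_add]; simp
      _ ≤ _ := by gcongr
  · have mono : MonotoneOn (fun s => h s * Real.exp (c * s)) (Icc (-T) T) := by
      refine monotoneOn_of_hasDerivWithinAt_nonneg (convex_Icc _ _)
        (fun s hs => (key c s hs).continuousWithinAt)
        (fun s hs => (key c s (interior_subset hs)).mono interior_subset) ?_
      intro s hs
      have := (abs_le.1 (hb s (interior_subset hs))).1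
      exact mul_nonneg (by linarith) (Real.exp_pos _).le
    have h2 := mono ht h0 h1
    simp only [mul_zero, Real.exp_zero, mul_one] at h2
    rw [abs_of_nonpos h1]
    calc h t = h t * Real.exp (c * t) * Real.exp (c * -t) := by
          rw [mul_assoc, ← Real.exp_add]; simp
      _ ≤ _ := by gcongr

variable {E : Type*} [NormedAddCommGroup E] [NormedSpace ℝ E] [FiniteDimensional ℝ E]

/-- A `C¹` vector field can be cut off outside a ball to become bounded and Lipschitz. -/
theorem exists_cutoff_field {X : E → E} (hX : ContDiff ℝ 1 X) (M : ℝ) :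
    ∃ (ρ : E → ℝ) (K L : NNReal), (∀ x, 0 ≤ ρ x ∧ ρ x ≤ 1) ∧ (∀ x, ‖x‖ ≤ M → ρ x = 1) ∧
      LipschitzWith K (fun x => ρ x • X x) ∧ ∀ x, ‖ρ x • X x‖ ≤ L := by
  -- The maximum with `1` keeps the inner radius positive even when `M ≤ 0`.
  let f : ContDiffBump (0 : E) := ⟨max M 1, max M 1 + 1, by positivity, by linarith⟩
  have hc : ContDiff ℝ 1 (fun x => f x • X x) := f.contDiff.smul hX
  have hs : HasCompactSupport (fun x => f x • X x) := f.hasCompactSupport.smul_right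
  obtain ⟨K, hK⟩ := ContDiff.lipschitzWith_of_hasCompactSupport hs hc one_ne_zero
  obtain ⟨L, hL⟩ := hc.continuous.bounded_above_of_compact_support hs
  refine ⟨f, K, L.toNNReal, fun x => ⟨f.nonneg, f.le_one⟩, fun x hx => ?_, hK,
    fun x => (hL x).trans (Real.le_coe_toNNReal L)⟩
  exact f.one_of_mem_closedBall (mem_closedBall_zero_iff.2 (hx.trans (le_max_left M 1)))

/-- Two integral curves of a `C¹` vector field with the same initial value agree. -/
theorem integralCurve_unique {X : E → E} (hX : ContDiff ℝ 1 X) {γ₁ γ₂ : ℝ → E} {T : ℝ}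
    (h₁ : ∀ t ∈ Icc (-T) T, HasDerivWithinAt γ₁ (X (γ₁ t)) (Icc (-T) T) t)
    (h₂ : ∀ t ∈ Icc (-T) T, HasDerivWithinAt γ₂ (X (γ₂ t)) (Icc (-T) T) t)
    (h0 : γ₁ 0 = γ₂ 0) : ∀ t ∈ Ioo (-T) T, γ₁ t = γ₂ t := by
  intro t ht
  have c₁ : ContinuousOn γ₁ (Icc (-T) T) := fun s hs => (h₁ s hs).continuousWithinAt
  have c₂ : ContinuousOn γ₂ (Icc (-T) T) := fun s hs => (h₂ s hs).continuousWithinAt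
  obtain ⟨M₁, hM₁⟩ := isCompact_Icc.exists_bound_of_continuousOn c₁
  obtain ⟨M₂, hM₂⟩ := isCompact_Icc.exists_bound_of_continuousOn c₂
  -- The cutoff is `1` along both curves, so both solve one globally Lipschitz equation.
  obtain ⟨ρ, K, L, -, hρ, hK, -⟩ := exists_cutoff_field hX (max M₁ M₂)
  have hT : 0 < T := by linarith [ht.1, ht.2]
  refine ODE_solution_unique_of_mem_Ioo (v := fun _ x => ρ x • X x) (s := fun _ => univ)
    (K := K) (t₀ := 0) (fun s _ => hK.lipschitzOnWith) ⟨by linarith, hT⟩ ?_ ?_ h0 ht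
  · intro s hs
    refine ⟨?_, trivial⟩
    rw [hρ _ (le_max_of_le_left (hM₁ s (Ioo_subset_Icc_self hs))), one_smul]
    exact (h₁ s (Ioo_subset_Icc_self hs)).hasDerivAt (Icc_mem_nhds hs.1 hs.2)
  · intro s hs
    refine ⟨?_, trivial⟩
    rw [hρ _ (le_max_of_le_right (hM₂ s (Ioo_subset_Icc_self hs))), one_smul]
    exact (h₂ s (Ioo_subset_Icc_self hs)).hasDerivAt (Icc_mem_nhds hs.1 hs.2)

variable {X : E → E} {H : E → ℝ} {H' : E → E →L[ℝ] ℝ} {c : ℝ}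

/-- The flow of a vector field with a Lyapunov function, on bounded sets of initial data and
bounded time intervals. -/
theorem exists_local_flow (hX : ContDiff ℝ 1 X) (hH : ∀ x, HasFDerivAt H (H' x) x)
    (hHn : ∀ x, ‖x‖ ^ 2 ≤ H x) (hc : ∀ x, |H' x (X x)| ≤ c * H x) {T : ℝ} (hT : 0 ≤ T) :
    ∃ Φ : E × ℝ → E, ContinuousOn Φ (closedBall 0 T ×ˢ Icc (-T) T) ∧
      ∀ z ∈ closedBall (0 : E) T, Φ (z, 0) = z ∧ ∀ t ∈ Icc (-T) T,
        HasDerivWithinAt (fun s => Φ (z, s)) (X (Φ (z, t))) (Icc (-T) T) t := by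
  have hHc : Continuous H := continuous_iff_continuousAt.2 fun x => (hH x).continuousAt
  obtain ⟨B, hB⟩ := (isCompact_closedBall (0 : E) T).exists_bound_of_continuousOn hHc.continuousOn
  have hH0 : ∀ x, 0 ≤ H x := fun x => (sq_nonneg _).trans (hHn x)
  -- The radius is the a priori Grönwall bound up to time `T`. As `0 ≤ ρ ≤ 1`, the cut-off field
  -- obeys the same growth estimate, so its curves never leave the region where `ρ = 1`.
  obtain ⟨ρ, K, L, hρ01, hρ, hK, hL⟩ :=
    exists_cutoff_field hX (Real.sqrt (|B| * Real.exp (|c| * T)))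
  let R : NNReal := ⟨T, hT⟩
  have hPL : IsPicardLindelof (fun _ x => ρ x • X x) (tmin := -T) (tmax := T)
      ⟨0, by linarith, hT⟩ (0 : E) (R + L * R) R L K := by
    refine .of_time_independent (fun x _ => hL x) hK.lipschitzOnWith ?_
    have : max (T - 0) (0 - -T) = T := by simp
    simp only [this, NNReal.coe_add, NNReal.coe_mul, add_sub_cancel_left]
    exact le_rfl
  obtain ⟨Φ, hΦ, hΦc⟩ := hPL.exists_forall_mem_closedBall_eq_hasDerivWithinAt_continuousOn
  refine ⟨Φ, hΦc, fun z hz => ⟨(hΦ z hz).1, fun t ht => ?_⟩⟩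
  have hz0 : Φ (z, 0) = z := (hΦ z hz).1
  have hd := (hΦ z hz).2
  have hest := le_mul_exp_of_abs_deriv_le (h := fun s => H (Φ (z, s)))
    (h' := fun s => H' (Φ (z, s)) (ρ (Φ (z, s)) • X (Φ (z, s)))) (c := |c|) (T := T)
    (fun s hs => (hH _).comp_hasDerivWithinAt s (hd s hs)) ?_ ht
  · have h1 : ‖Φ (z, t)‖ ≤ Real.sqrt (|B| * Real.exp (|c| * T)) := by
      apply Real.le_sqrt_of_sq_le
      refine (hHn _).trans (hest.trans ?_)
      have hb : H (Φ (z, 0)) ≤ |B| := by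
        rw [hz0]
        exact (le_abs_self _).trans ((hB z hz).trans (le_abs_self _))
      have : |t| ≤ T := abs_le.2 ht
      gcongr
    have := hd t ht
    rwa [hρ _ h1, one_smul] at this
  · intro s hs
    simp only [map_smul, smul_eq_mul, abs_mul]
    have h1 := hc (Φ (z, s))
    have h2 := hρ01 (Φ (z, s))
    rw [abs_of_nonneg h2.1]
    calc ρ (Φ (z, s)) * |H' (Φ (z, s)) (X (Φ (z, s)))| ≤ 1 * (c * H (Φ (z, s))) := by
          gcongr
          exact h2.2
      _ ≤ |c| * H (Φ (z, s)) := by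
          rw [one_mul]
          exact mul_le_mul_of_nonneg_right (le_abs_self c) (hH0 _)

/-- A `C¹` vector field with a Lyapunov function generates a global continuous flow. -/
theorem exists_global_flow (hX : ContDiff ℝ 1 X) (hH : ∀ x, HasFDerivAt H (H' x) x)
    (hHn : ∀ x, ‖x‖ ^ 2 ≤ H x) (hc : ∀ x, |H' x (X x)| ≤ c * H x) :
    ∃ Φ : E × ℝ → E, Continuous Φ ∧ ∀ z, Φ (z, 0) = z ∧ ∀ t,
      HasDerivAt (fun s => Φ (z, s)) (X (Φ (z, t))) t := by
  have hflow := fun n : ℕ => exists_local_flow hX hH hHn hc (T := n) n.cast_nonneg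
  choose F hFc hF using hflow
  have agree : ∀ m n : ℕ, m ≤ n → ∀ z : E, ‖z‖ ≤ m → ∀ t : ℝ, |t| < m →
      F m (z, t) = F n (z, t) := by
    intro m n hmn z hz t ht
    have hmn' : (m : ℝ) ≤ n := by exact_mod_cast hmn
    have hsub : Icc (-(m : ℝ)) m ⊆ Icc (-(n : ℝ)) n := Icc_subset_Icc (by linarith) hmn'
    have hzm : z ∈ closedBall (0 : E) m := by simpa using hz
    have hzn : z ∈ closedBall (0 : E) n := by simpa using hz.trans hmn'
    refine integralCurve_unique hX (T := m) (γ₁ := fun s => F m (z, s))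
      (γ₂ := fun s => F n (z, s)) (hF m z hzm).2
      (fun s hs => ((hF n z hzn).2 s (hsub hs)).mono hsub) ?_ t (abs_lt.1 ht)
    simp only [(hF m z hzm).1, (hF n z hzn).1]
  -- The `+ 1` makes the bounds strict, so one index serves a whole neighbourhood.
  let idx : E × ℝ → ℕ := fun q => ⌈max ‖q.1‖ |q.2|⌉₊ + 1
  have hidx : ∀ q, ‖q.1‖ < idx q ∧ |q.2| < idx q := by
    intro q
    have := Nat.le_ceil (max ‖q.1‖ |q.2|)
    have h1 := le_max_left ‖q.1‖ |q.2|
    have h2 := le_max_right ‖q.1‖ |q.2|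
    constructor <;> simp only [idx, Nat.cast_add, Nat.cast_one] <;> linarith
  let Φ : E × ℝ → E := fun q => F (idx q) q
  have hΦ : ∀ (n : ℕ) (q : E × ℝ), ‖q.1‖ < n → |q.2| < n → Φ q = F n q := by
    rintro n ⟨z, t⟩ h1 h2
    rcases le_total (idx (z, t)) n with h | h
    · exact agree _ _ h z (hidx (z, t)).1.le t (hidx (z, t)).2
    · exact (agree _ _ h z h1.le t h2).symm
  have hΦev : ∀ q : E × ℝ, Φ =ᶠ[𝓝 q] F (idx q) := by
    intro q
    have o1 : ∀ᶠ p : E × ℝ in 𝓝 q, ‖p.1‖ < idx q :=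
      (continuous_fst.norm.continuousAt).eventually_lt continuousAt_const (hidx q).1
    have o2 : ∀ᶠ p : E × ℝ in 𝓝 q, |p.2| < idx q :=
      (continuous_snd.abs.continuousAt).eventually_lt continuousAt_const (hidx q).2
    filter_upwards [o1, o2] with p h1 h2 using hΦ _ p h1 h2
  refine ⟨Φ, continuous_iff_continuousAt.2 fun q => ?_, fun z => ⟨?_, fun t => ?_⟩⟩
  · refine ContinuousAt.congr ?_ (hΦev q).symm
    refine (hFc (idx q)).continuousAt (prod_mem_nhds ?_ ?_)
    · exact mem_of_superset (isOpen_ball.mem_nhds (by simpa using (hidx q).1))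
        ball_subset_closedBall
    · exact Icc_mem_nhds (abs_lt.1 (hidx q).2).1 (abs_lt.1 (hidx q).2).2
  · exact (hF _ z (by simpa using (hidx (z, 0)).1.le)).1
  · have hz : z ∈ closedBall (0 : E) (idx (z, t)) := by simpa using (hidx (z, t)).1.le
    have ht := abs_lt.1 (hidx (z, t)).2
    have hd := ((hF _ z hz).2 t ⟨ht.1.le, ht.2.le⟩).hasDerivAt (Icc_mem_nhds ht.1 ht.2)
    refine hd.congr_of_eventuallyEq ?_
    exact (hΦev (z, t)).comp_tendsto (Continuous.tendsto' (by fun_prop) t (z, t) rfl)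

end GlobalFlow

/-! ### Phase-plane analysis of the Emden–Fowler equation -/

section Orbits

/-- Solutions of `w'' - b w' - β w + |w|^α w = 0`, written as a first order system. -/
structure IsOrbit (α β b : ℝ) (w v : ℝ → ℝ) : Prop where
  hasDerivAt_fst : ∀ s, HasDerivAt w (v s) s
  hasDerivAt_snd : ∀ s, HasDerivAt v (b * v s + β * w s - |w s| ^ α * w s) s

/-- The energy `v²/2 - β w²/2 + |w|^(α+2)/(α+2)`. -/
noncomputable def energy (α β w v : ℝ) : ℝ :=
  v ^ 2 / 2 - β * w ^ 2 / 2 + |w| ^ (α + 2) / (α + 2)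

/-- The positive `w` with `energy α β w 0 = 0`. -/
noncomputable def zeroEnergyAmplitude (α β : ℝ) : ℝ := (β * (α + 2) / 2) ^ (1 / α)

variable {α β b : ℝ} {w v : ℝ → ℝ}

theorem abs_rpow_add_two (hα : 0 < α) (x : ℝ) : |x| ^ (α + 2) = |x| ^ α * x ^ 2 := by
  rw [Real.rpow_add_of_nonneg (abs_nonneg x) hα.le zero_le_two]
  simp

theorem hasDerivAt_abs_rpow_div (hα : 0 < α) (x : ℝ) :
    HasDerivAt (fun x : ℝ => |x| ^ (α + 2) / (α + 2)) (|x| ^ α * x) x := by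
  refine ((hasDerivAt_abs_rpow x (p := α + 2) (by linarith)).div_const (α + 2)).congr_deriv ?_
  rw [add_sub_cancel_right]
  field_simp

/-- In this factored form the potential part changes sign exactly where `|x|` crosses
`zeroEnergyAmplitude`; every trapping and speed estimate below reads it off here. -/
theorem energy_eq (hα : 0 < α) (x y : ℝ) :
    energy α β x y = y ^ 2 / 2 - x ^ 2 * (β / 2 - |x| ^ α / (α + 2)) := by
  rw [energy, abs_rpow_add_two hα]
  ring

theorem continuous_energy (hα : 0 < α) : Continuous fun z : ℝ × ℝ => energy α β z.1 z.2 := by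
  unfold energy
  have : Continuous fun z : ℝ × ℝ => |z.1| ^ (α + 2) :=
    continuous_fst.abs.rpow_const fun _ => Or.inr (by linarith)
  fun_prop

theorem zeroEnergyAmplitude_pos (hα : 0 < α) (hβ : 0 < β) : 0 < zeroEnergyAmplitude α β :=
  Real.rpow_pos_of_pos (by positivity) _

theorem zeroEnergyAmplitude_rpow (hα : 0 < α) (hβ : 0 < β) :
    zeroEnergyAmplitude α β ^ α = β * (α + 2) / 2 := by
  rw [zeroEnergyAmplitude, ← Real.rpow_mul (by positivity), one_div_mul_cancel hα.ne',
    Real.rpow_one]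

theorem rpow_le_iff_le_zeroEnergyAmplitude (hα : 0 < α) (hβ : 0 < β) {x : ℝ} (hx : 0 ≤ x) :
    x ^ α ≤ β * (α + 2) / 2 ↔ x ≤ zeroEnergyAmplitude α β := by
  rw [← zeroEnergyAmplitude_rpow hα hβ,
    Real.rpow_le_rpow_iff hx (zeroEnergyAmplitude_pos hα hβ).le hα]

/-- A function whose derivative is at least `κ > 0` on a half-line is unbounded above there. -/
theorem exists_gt_of_deriv_ge {f f' : ℝ → ℝ} {a κ : ℝ} (hκ : 0 < κ)
    (hf : ∀ s ≥ a, HasDerivAt f (f' s) s) (hf' : ∀ s ≥ a, κ ≤ f' s) (B : ℝ) :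
    ∃ s ≥ a, B < f s := by
  have mono : MonotoneOn (fun s => f s - κ * s) (Ici a) := by
    have hd : ∀ s ≥ a, HasDerivAt (fun s => f s - κ * s) (f' s - κ * 1) s := fun s hs =>
      (hf s hs).sub ((hasDerivAt_id s).const_mul κ)
    refine monotoneOn_of_hasDerivWithinAt_nonneg (f' := fun s => f' s - κ * 1) (convex_Ici a)
      (fun s hs => (hd s hs).continuousAt.continuousWithinAt)
      (fun s hs => (hd s (interior_subset hs)).hasDerivWithinAt) ?_
    intro s hs
    have := hf' s (interior_subset hs)
    linarith
  let t := max a (a + (B - f a + 1) / κ)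
  have hat : a ≤ t := le_max_left _ _
  refine ⟨t, hat, ?_⟩
  have h1 := mono self_mem_Ici (show t ∈ Ici a from hat) hat
  have h2 : a + (B - f a + 1) / κ ≤ t := le_max_right _ _
  have h3 : (B - f a + 1) / κ * κ = B - f a + 1 := div_mul_cancel₀ _ hκ.ne'
  have h4 : κ * (a + (B - f a + 1) / κ) ≤ κ * t := by gcongr
  simp only at h1
  nlinarith

/-- A function whose derivative is at most `-κ < 0` on a half-line is unbounded below there. -/
theorem exists_lt_of_deriv_le {f f' : ℝ → ℝ} {a κ : ℝ} (hκ : 0 < κ)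
    (hf : ∀ s ≥ a, HasDerivAt f (f' s) s) (hf' : ∀ s ≥ a, f' s ≤ -κ) (B : ℝ) :
    ∃ s ≥ a, f s < B := by
  obtain ⟨s, hs, h⟩ := exists_gt_of_deriv_ge (f := fun s => -f s) (f' := fun s => -f' s) hκ
    (fun s hs => (hf s hs).neg) (fun s hs => by have := hf' s hs; linarith) (-B)
  exact ⟨s, hs, by linarith⟩

namespace IsOrbit

theorem neg (h : IsOrbit α β b w v) : IsOrbit α β b (fun s => -w s) (fun s => -v s) where
  hasDerivAt_fst s := (h.hasDerivAt_fst s).neg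
  hasDerivAt_snd s := (h.hasDerivAt_snd s).neg.congr_deriv (by rw [abs_neg]; ring)

theorem continuous_fst (h : IsOrbit α β b w v) : Continuous w :=
  continuous_iff_continuousAt.2 fun s => (h.hasDerivAt_fst s).continuousAt

theorem continuous_snd (h : IsOrbit α β b w v) : Continuous v :=
  continuous_iff_continuousAt.2 fun s => (h.hasDerivAt_snd s).continuousAt

/-- The conservative terms cancel; only the anti-damping `b v` does work. -/
theorem hasDerivAt_energy (hα : 0 < α) (h : IsOrbit α β b w v) (s : ℝ) :
    HasDerivAt (fun s => energy α β (w s) (v s)) (b * v s ^ 2) s := by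
  have h1 := (((h.hasDerivAt_snd s).pow 2).div_const 2).sub
    ((((h.hasDerivAt_fst s).pow 2).const_mul β).div_const 2)
  have h2 := (hasDerivAt_abs_rpow_div hα (w s)).comp s (h.hasDerivAt_fst s)
  refine (h1.add h2).congr_deriv ?_
  push_cast
  ring

theorem monotone_energy (hα : 0 < α) (hb : 0 < b) (h : IsOrbit α β b w v) :
    Monotone fun s => energy α β (w s) (v s) :=
  monotone_of_hasDerivAt_nonneg (h.hasDerivAt_energy hα) fun s => by positivity

/-- Orbits grow at most like `e^{bs}`. -/
theorem exists_forward_bound (hα : 0 < α) (hβ : 0 < β) (hb : 0 < b) (h : IsOrbit α β b w v) :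
    ∃ C, ∀ s, 0 ≤ s → |w s| ≤ C * Real.exp (b * s) := by
  set A := zeroEnergyAmplitude α β with hA
  have hA0 : 0 < A := zeroEnergyAmplitude_pos hα hβ
  -- The potential is at least `-β A² / 2`: it is nonnegative for `|x| ≥ A`, and elsewhere `x² ≤
  -- A²`. Hence the shifted energy `e` controls `v²/2` and satisfies `e' ≤ 2b e`.
  have hlow : ∀ x y, y ^ 2 / 2 ≤ energy α β x y + β * A ^ 2 / 2 := by
    intro x y
    rw [energy_eq hα]
    rcases le_total (|x| ^ α) (β * (α + 2) / 2) with hx | hx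
    · have h1 : |x| ≤ A := (rpow_le_iff_le_zeroEnergyAmplitude hα hβ (abs_nonneg x)).1 hx
      have h2 : x ^ 2 ≤ A ^ 2 := by rw [← sq_abs x]; gcongr
      have h3 : 0 ≤ x ^ 2 * (|x| ^ α / (α + 2)) := by positivity
      nlinarith
    · have h1 : β / 2 ≤ |x| ^ α / (α + 2) := by
        rw [le_div_iff₀ (by linarith)]; linarith
      have h2 : 0 ≤ x ^ 2 * (|x| ^ α / (α + 2) - β / 2) :=
        mul_nonneg (sq_nonneg _) (by linarith)
      have h3 : 0 ≤ β * A ^ 2 / 2 := by positivity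
      linarith
  let e := fun s => energy α β (w s) (v s) + β * A ^ 2 / 2
  have he : ∀ s, 0 ≤ e s := fun s => (by positivity : 0 ≤ v s ^ 2 / 2).trans (hlow _ _)
  have hed : ∀ s, HasDerivAt e (b * v s ^ 2) s := fun s =>
    (h.hasDerivAt_energy hα s).add_const _
  let K := Real.sqrt (2 * e 0)
  have hv : ∀ s, 0 ≤ s → |v s| ≤ K * Real.exp (b * s) := by
    intro s hs
    have h1 := le_mul_exp_of_abs_deriv_le (h := e) (h' := fun s => b * v s ^ 2) (c := 2 * b)
      (T := s) (fun t _ => (hed t).hasDerivWithinAt) (fun t _ => ?_)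
      (t := s) ⟨by linarith, le_rfl⟩
    · rw [← Real.sqrt_sq_eq_abs]
      have h2 : Real.exp (b * s) = Real.sqrt (Real.exp (2 * b * |s|)) := by
        rw [Real.sqrt_eq_rpow, ← Real.exp_mul, abs_of_nonneg hs]
        ring_nf
      rw [h2, ← Real.sqrt_mul (by have := he 0; linarith)]
      apply Real.sqrt_le_sqrt
      have := hlow (w s) (v s)
      change v s ^ 2 / 2 ≤ e s at this
      linarith
    · rw [abs_of_nonneg (by positivity)]
      have : v t ^ 2 / 2 ≤ e t := hlow (w t) (v t)
      nlinarith
  have hK : 0 ≤ K := Real.sqrt_nonneg _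
  refine ⟨|w 0| + K / b, fun s hs => ?_⟩
  have hB : ∀ t, HasDerivAt (fun t => |w 0| + K / b * Real.exp (b * t)) (K * Real.exp (b * t)) t := by
    intro t
    have h1 : HasDerivAt (fun s => Real.exp (b * s)) (Real.exp (b * t) * (b * 1)) t :=
      ((hasDerivAt_id t).const_mul b).exp
    refine ((h1.const_mul (K / b)).const_add |w 0|).congr_deriv ?_
    field_simp
  have h1 := image_norm_le_of_norm_deriv_right_le_deriv_boundary (f := w) (f' := v) (a := 0)
    (b := s) h.continuous_fst.continuousOn
    (fun t _ => (h.hasDerivAt_fst t).hasDerivWithinAt) (B := fun t => |w 0| + K / b * Real.exp (b * t))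
    (by simp only [Real.norm_eq_abs]; have : 0 ≤ K / b * Real.exp (b * 0) := by positivity
        linarith) hB (fun t ht => hv t ht.1) ⟨hs, le_rfl⟩
  have h2 : 1 ≤ Real.exp (b * s) := Real.one_le_exp (by positivity)
  calc |w s| ≤ |w 0| + K / b * Real.exp (b * s) := h1
    _ ≤ |w 0| * Real.exp (b * s) + K / b * Real.exp (b * s) := by
      gcongr
      exact le_mul_of_one_le_right (abs_nonneg _) h2
    _ = _ := by ring

/-- An orbit with negative energy at time `0` stays, for negative times, in a compact part of the
half-plane it started in. -/
theorem exists_backward_bound (hα : 0 < α) (hβ : 0 < β) (hb : 0 < b) (h : IsOrbit α β b w v)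
    (h0 : energy α β (w 0) (v 0) < 0) (hw0 : 0 < w 0) :
    ∃ m > 0, ∃ C, ∀ s ≤ 0, m ≤ w s ∧ w s ≤ C ∧ |v s| ≤ C := by
  set e := -energy α β (w 0) (v 0) with he
  set A := zeroEnergyAmplitude α β with hA
  have he0 : 0 < e := by linarith
  have hE : ∀ s ≤ 0, v s ^ 2 / 2 - w s ^ 2 * (β / 2 - |w s| ^ α / (α + 2)) ≤ -e := by
    intro s hs
    rw [← energy_eq hα, he, neg_neg]
    exact h.monotone_energy hα hb hs
  have hsq : ∀ s ≤ 0, 2 * e / β ≤ w s ^ 2 := by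
    intro s hs
    rw [div_le_iff₀ hβ]
    have h1 : 0 ≤ w s ^ 2 * (|w s| ^ α / (α + 2)) := by positivity
    nlinarith [hE s hs, sq_nonneg (v s)]
  have hne : ∀ s ≤ 0, w s ≠ 0 := by
    intro s hs h1
    have := hsq s hs
    rw [h1] at this
    have h2 : 0 < 2 * e / β := by positivity
    norm_num at this
    linarith
  have hpos : ∀ s ≤ 0, 0 < w s := by
    intro s hs
    -- Negative energy excludes `w = 0`, so a sign change contradicts the intermediate value
    -- theorem.
    by_contra! hneg
    obtain ⟨t, ht, ht0⟩ := intermediate_value_Icc hs h.continuous_fst.continuousOn ⟨hneg, hw0.le⟩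
    exact hne t ht.2 ht0
  have hle : ∀ s ≤ 0, w s ≤ A := by
    intro s hs
    rw [hA, ← rpow_le_iff_le_zeroEnergyAmplitude hα hβ (hpos s hs).le]
    by_contra! h1
    have h2 : β / 2 ≤ |w s| ^ α / (α + 2) := by
      rw [abs_of_pos (hpos s hs), le_div_iff₀ (by linarith)]; linarith
    have h3 : 0 ≤ w s ^ 2 * (|w s| ^ α / (α + 2) - β / 2) :=
      mul_nonneg (sq_nonneg _) (by linarith)
    nlinarith [hE s hs, sq_nonneg (v s)]
  have hA0 : 0 < A := zeroEnergyAmplitude_pos hα hβ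
  refine ⟨Real.sqrt (2 * e / β), Real.sqrt_pos.2 (by positivity),
    max A (Real.sqrt (β * A ^ 2)), fun s hs => ⟨?_, ?_, ?_⟩⟩
  · exact (Real.sqrt_le_left (hpos s hs).le).2 (hsq s hs)
  · exact (hle s hs).trans (le_max_left _ _)
  · refine le_trans (Real.abs_le_sqrt ?_) (le_max_right _ _)
    have h1 : 0 ≤ w s ^ 2 * (|w s| ^ α / (α + 2)) := by positivity
    have h2 : w s ^ 2 ≤ A ^ 2 := by
      have := hpos s hs
      have := hle s hs
      gcongr
    nlinarith [hE s hs]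

/-- An orbit that is positive at late times with positive energy cannot have `w` increasing
forever. -/
theorem exists_snd_nonpos (hα : 0 < α) (hβ : 0 < β) (hb : 0 < b) (h : IsOrbit α β b w v)
    {S e : ℝ} (he : 0 < e) (hE : ∀ s ≥ S, e ≤ energy α β (w s) (v s)) (hpos : ∀ s ≥ S, 0 < w s) :
    ∃ s ≥ S, v s ≤ 0 := by
  by_contra! hv
  set A := zeroEnergyAmplitude α β with hA
  have hA0 : 0 < A := zeroEnergyAmplitude_pos hα hβ
  have mono : MonotoneOn w (Ici S) :=
    monotoneOn_of_hasDerivWithinAt_nonneg (convex_Ici S) h.continuous_fst.continuousOn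
      (fun s _ => (h.hasDerivAt_fst s).hasDerivWithinAt) fun s hs => (hv s (interior_subset hs)).le
  -- While `w ≤ A` the potential is nonpositive, so `v² ≥ 2e` and `w` must pass `A`.
  obtain ⟨s₃, hs₃, hw₃⟩ : ∃ s ≥ S, A < w s := by
    by_contra! hle
    have hd : ∀ s ≥ S, Real.sqrt (2 * e) ≤ v s := by
      intro s hs
      rw [Real.sqrt_le_left (hv s hs).le]
      have h1 := hE s hs
      rw [energy_eq hα] at h1
      have h2 := (rpow_le_iff_le_zeroEnergyAmplitude hα hβ (hpos s hs).le).2 (hle s hs)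
      have h3 : |w s| ^ α / (α + 2) ≤ β / 2 := by
        rw [abs_of_pos (hpos s hs), div_le_iff₀ (by linarith)]; linarith
      have h4 : 0 ≤ w s ^ 2 * (β / 2 - |w s| ^ α / (α + 2)) :=
        mul_nonneg (sq_nonneg _) (by linarith)
      linarith
    obtain ⟨s, hs, hlt⟩ := exists_gt_of_deriv_ge (Real.sqrt_pos.2 (by linarith))
      (fun s _ => h.hasDerivAt_fst s) hd A
    exact absurd (hle s hs) (not_le.2 hlt)
  have hw₃0 : 0 < w s₃ := hA0.trans hw₃
  have hκ : 0 < w s₃ ^ α - β := by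
    have h1 : A ^ α < w s₃ ^ α := Real.rpow_lt_rpow hA0.le hw₃ hα
    rw [hA, zeroEnergyAmplitude_rpow hα hβ] at h1
    nlinarith
  have hge : ∀ s ≥ s₃, w s₃ ≤ w s := fun s hs => mono hs₃ (hs₃.trans hs : S ≤ s) hs
  -- Beyond `A` the quantity `v - b w` decreases at a uniform rate; since `v > 0`, this forces `w`
  -- to be unbounded.
  have hunb : ∀ B, ∃ s ≥ s₃, B < w s := by
    intro B
    have hd : ∀ s ≥ s₃, b * v s + β * w s - |w s| ^ α * w s - b * v s ≤
        -(w s₃ * (w s₃ ^ α - β)) := by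
      intro s hs
      have h1 := hge s hs
      have h2 : w s₃ ^ α ≤ w s ^ α := by gcongr
      have h3 : w s₃ * (w s₃ ^ α - β) ≤ w s * (w s ^ α - β) := by
        have := hw₃0.le.trans h1
        gcongr
      rw [abs_of_pos (hpos s (hs₃.trans hs))]
      linarith
    obtain ⟨s, hs, hlt⟩ := exists_lt_of_deriv_le (f := fun s => v s - b * w s) (by positivity)
      (fun s _ => (h.hasDerivAt_snd s).sub ((h.hasDerivAt_fst s).const_mul b)) hd (-(b * B))
    refine ⟨s, hs, ?_⟩
    have := hv s (hs₃.trans hs)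
    nlinarith
  -- The threshold comes from the Riccati equation for `z = v / w`: `z' = b z - z² + β - w^α ≤ b²/4
  -- + β - w^α ≤ -1`. Then `z` becomes negative, against `v > 0`.
  obtain ⟨s₄, hs₄, hw₄⟩ := hunb ((β + b ^ 2 / 4 + 1) ^ (1 / α))
  have hS₄ : S ≤ s₄ := hs₃.trans hs₄
  have hbig : ∀ s ≥ s₄, β + b ^ 2 / 4 + 1 ≤ w s ^ α := by
    intro s hs
    have h1 : (β + b ^ 2 / 4 + 1) ^ (1 / α) ≤ w s :=
      hw₄.le.trans (mono hS₄ (hS₄.trans hs : S ≤ s) hs)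
    have h2 := Real.rpow_le_rpow (by positivity) h1 hα.le
    rwa [← Real.rpow_mul (by positivity), one_div_mul_cancel hα.ne', Real.rpow_one] at h2
  have hd : ∀ s ≥ s₄,
      ((b * v s + β * w s - |w s| ^ α * w s) * w s - v s * v s) / w s ^ 2 ≤ -1 := by
    intro s hs
    have hp := hpos s (hS₄.trans hs)
    rw [div_le_iff₀ (by positivity), abs_of_pos hp]
    have h1 : (β + b ^ 2 / 4 + 1) * w s ^ 2 ≤ w s ^ α * w s ^ 2 := by
      gcongr
      exact hbig s hs
    nlinarith [sq_nonneg (v s - b / 2 * w s)]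
  obtain ⟨s, hs, hlt⟩ := exists_lt_of_deriv_le (f := fun s => v s / w s) one_pos
    (fun s hs => (h.hasDerivAt_snd s).div (h.hasDerivAt_fst s) (hpos s (hS₄.trans hs)).ne') hd 0
  exact absurd hlt (not_lt.2 (div_pos (hv s (hS₄.trans hs)) (hpos s (hS₄.trans hs))).le)

/-- An orbit that attains positive energy takes negative values at arbitrarily late times. -/
theorem exists_neg (hα : 0 < α) (hβ : 0 < β) (hb : 0 < b) (h : IsOrbit α β b w v)
    {s₁ : ℝ} (h₁ : 0 < energy α β (w s₁) (v s₁)) (S : ℝ) : ∃ s > S, w s < 0 := by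
  by_contra! hnn
  set A := zeroEnergyAmplitude α β with hA
  have hA0 : 0 < A := zeroEnergyAmplitude_pos hα hβ
  set e := energy α β (w s₁) (v s₁) with he
  set T := max S s₁ + 1 with hT
  have hST : ∀ s ≥ T, S < s ∧ s₁ ≤ s := by
    intro s hs
    have h1 := le_max_left S s₁
    have h2 := le_max_right S s₁
    constructor <;> linarith
  have hE : ∀ s ≥ T, e ≤ energy α β (w s) (v s) := fun s hs =>
    h.monotone_energy hα hb (hST s hs).2
  -- A zero of the nonnegative `w` would be a minimum, where `w = v = 0` and the energy vanishes.
  have hpos : ∀ s ≥ T, 0 < w s := by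
    intro s hs
    refine lt_of_le_of_ne (hnn s (hST s hs).1) fun h0 => ?_
    have hmin : IsLocalMin w s := by
      filter_upwards [lt_mem_nhds (hST s hs).1] with t ht
      rw [← h0]
      exact hnn t ht
    have hv0 := hmin.hasDerivAt_eq_zero (h.hasDerivAt_fst s)
    have h1 := hE s hs
    rw [energy_eq hα, hv0, ← h0] at h1
    norm_num at h1
    linarith
  -- where `w` is at most `A`, the speed is bounded below
  have hspeed : ∀ s ≥ T, w s ≤ A → 2 * e ≤ v s ^ 2 := by
    intro s hs hle
    have h1 := hE s hs
    rw [energy_eq hα] at h1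
    have h2 := (rpow_le_iff_le_zeroEnergyAmplitude hα hβ (hpos s hs).le).2 hle
    have h3 : |w s| ^ α / (α + 2) ≤ β / 2 := by
      rw [abs_of_pos (hpos s hs), div_le_iff₀ (by linarith)]; linarith
    have h4 : 0 ≤ w s ^ 2 * (β / 2 - |w s| ^ α / (α + 2)) :=
      mul_nonneg (sq_nonneg _) (by linarith)
    linarith
  set κ := A * (A ^ α - β) with hκ
  have hκ0 : 0 < κ := by
    have : 0 < A ^ α - β := by
      rw [hA, zeroEnergyAmplitude_rpow hα hβ]
      nlinarith
    positivity
  have hforce : ∀ s, A ≤ w s → β * w s - |w s| ^ α * w s ≤ -κ := by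
    intro s hs
    have h1 : A ^ α ≤ w s ^ α := by gcongr
    have h2 : 0 ≤ A ^ α - β := by nlinarith
    have h3 : κ ≤ w s * (w s ^ α - β) := by
      have := hA0.le.trans hs
      rw [hκ]; gcongr
    rw [abs_of_pos (hA0.trans_le hs)]
    linarith
  obtain ⟨s₂, hs₂, hv₂⟩ := h.exists_snd_nonpos hα hβ hb h₁ hE hpos
  -- Barrier argument: where `v = 0`, positive energy forces `w ≥ A`, and there `v' ≤ -κ < 0`, so
  -- `v` cannot cross `0` upwards.
  have hv : ∀ s ≥ s₂, v s ≤ 0 := by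
    intro s hs
    refine image_le_of_deriv_right_lt_deriv_boundary (f := v) (a := s₂) (b := s) (B := fun _ => 0)
      (B' := fun _ => 0) h.continuous_snd.continuousOn
      (fun t _ => (h.hasDerivAt_snd t).hasDerivWithinAt) hv₂ (fun t => hasDerivAt_const t 0)
      (fun t ht h0 => ?_) ⟨hs, le_rfl⟩
    have hAt : A ≤ w t := by
      by_contra! hlt
      have := hspeed t (hs₂.trans ht.1) hlt.le
      rw [h0] at this
      norm_num at this
      linarith
    have := hforce t hAt
    rw [h0]
    linarith
  have anti : AntitoneOn w (Ici s₂) :=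
    antitoneOn_of_hasDerivWithinAt_nonpos (convex_Ici s₂) h.continuous_fst.continuousOn
      (fun s _ => (h.hasDerivAt_fst s).hasDerivWithinAt) fun s hs => hv s (interior_subset hs)
  -- If `w` stayed above `A`, then `v` would fall below `-1` for good and drive `w` negative. Once
  -- `w ≤ A`, monotonicity keeps it there and the speed bound carries it through `0`.
  obtain ⟨s₃, hs₃, hw₃⟩ : ∃ s ≥ s₂, w s ≤ A := by
    by_contra! hgt
    have hvd : ∀ s ≥ s₂, b * v s + β * w s - |w s| ^ α * w s ≤ -κ := by
      intro s hs
      have := hforce s (hgt s hs).le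
      have := mul_nonpos_of_nonneg_of_nonpos hb.le (hv s hs)
      linarith
    obtain ⟨s₄, hs₄, hv₄⟩ := exists_lt_of_deriv_le hκ0 (fun s _ => h.hasDerivAt_snd s) hvd (-1)
    have vanti : AntitoneOn v (Ici s₂) :=
      antitoneOn_of_hasDerivWithinAt_nonpos (convex_Ici s₂) h.continuous_snd.continuousOn
        (fun s _ => (h.hasDerivAt_snd s).hasDerivWithinAt)
        fun s hs => by have := hvd s (interior_subset hs); linarith
    obtain ⟨s, hs, hlt⟩ := exists_lt_of_deriv_le one_pos (a := s₄) (fun s _ => h.hasDerivAt_fst s)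
      (fun s hs => (vanti hs₄ (hs₄.trans hs : s₂ ≤ s) hs).trans hv₄.le) 0
    exact absurd (hpos s (hs₂.trans (hs₄.trans hs))) (not_lt.2 hlt.le)
  have hd : ∀ s ≥ s₃, v s ≤ -Real.sqrt (2 * e) := by
    intro s hs
    have hs' : s₂ ≤ s := hs₃.trans hs
    have h1 := hspeed s (hs₂.trans hs') ((anti hs₃ hs' hs).trans hw₃)
    have h2 := Real.sqrt_le_sqrt h1
    rw [Real.sqrt_sq_eq_abs, abs_of_nonpos (hv s hs')] at h2
    linarith
  obtain ⟨s, hs, hlt⟩ := exists_lt_of_deriv_le (Real.sqrt_pos.2 (by linarith))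
    (fun s _ => h.hasDerivAt_fst s) hd 0
  exact absurd (hpos s (hs₂.trans (hs₃.trans hs))) (not_lt.2 hlt.le)

/-- An orbit that attains positive energy takes positive values at arbitrarily late times. -/
theorem exists_pos (hα : 0 < α) (hβ : 0 < β) (hb : 0 < b) (h : IsOrbit α β b w v)
    {s₁ : ℝ} (h₁ : 0 < energy α β (w s₁) (v s₁)) (S : ℝ) : ∃ s > S, 0 < w s := by
  obtain ⟨s, hs, hlt⟩ := h.neg.exists_neg hα hβ hb (s₁ := s₁) (by simpa [energy] using h₁) S
  exact ⟨s, hs, by linarith⟩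

/-- The orbit through `(zeroEnergyAmplitude α β, 0)` has positive energy at time `1`. -/
theorem energy_one_pos (hα : 0 < α) (hβ : 0 < β) (hb : 0 < b) (h : IsOrbit α β b w v)
    (hw0 : w 0 = zeroEnergyAmplitude α β) (hv0 : v 0 = 0) : 0 < energy α β (w 1) (v 1) := by
  set A := zeroEnergyAmplitude α β with hA
  have hA0 : 0 < A := zeroEnergyAmplitude_pos hα hβ
  have hAα : A ^ α = β * (α + 2) / 2 := zeroEnergyAmplitude_rpow hα hβ
  have hE0 : energy α β (w 0) (v 0) = 0 := by
    rw [energy_eq hα, hw0, hv0, abs_of_pos hA0, hAα]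
    field_simp
    ring
  by_contra! hle
  have mono := h.monotone_energy hα hb
  have hE : ∀ s ∈ Icc (0 : ℝ) 1, energy α β (w s) (v s) = 0 := fun s hs =>
    le_antisymm ((mono hs.2).trans hle) (hE0.symm.le.trans (mono hs.1))
  -- Constant energy gives `b v² = 0`; stopping at `1/2` leaves a two-sided neighbourhood for each
  -- `s > 0`. But `v'(0) = A (β - A^α) = -α β A / 2 ≠ 0`.
  have hv : ∀ s ∈ Icc (0 : ℝ) (1 / 2), v s = 0 := by
    intro s hs
    rcases hs.1.eq_or_lt with rfl | hs0
    · exact hv0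
    have hev : (fun s => energy α β (w s) (v s)) =ᶠ[𝓝 s] fun _ => 0 := by
      filter_upwards [Icc_mem_nhds hs0 (show s < 1 by linarith [hs.2])] with t ht using hE t ht
    have := (h.hasDerivAt_energy hα s).unique ((hasDerivAt_const s (0 : ℝ)).congr_of_eventuallyEq hev)
    simpa [hb.ne'] using this
  have h0 : (0 : ℝ) ∈ Icc (0 : ℝ) (1 / 2) := by norm_num
  have hd : HasDerivWithinAt v 0 (Icc 0 (1 / 2)) 0 :=
    (hasDerivWithinAt_const (0 : ℝ) (Icc (0 : ℝ) (1 / 2)) (0 : ℝ)).congr hv hv0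
  have huniq := (uniqueDiffOn_Icc (by norm_num : (0 : ℝ) < 1 / 2) 0 h0).eq_deriv _
    (h.hasDerivAt_snd 0).hasDerivWithinAt hd
  rw [hw0, hv0, abs_of_pos hA0, hAα] at huniq
  nlinarith [mul_pos (mul_pos hβ hα) hA0]

end IsOrbit

end Orbits

/-! ### Derivatives and local integrability of `‖x‖^(-a) q(log ‖x‖)` -/

section RadialFunctions

variable {E : Type*} [NormedAddCommGroup E]

/-- The radial function `‖x‖^(-a) q(log ‖x‖)`. -/
noncomputable def radialPower (a : ℝ) (q : ℝ → ℝ) (x : E) : ℝ := ‖x‖ ^ (-a) * q (Real.log ‖x‖)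

variable {a : ℝ} {q q' : ℝ → ℝ}

theorem sq_norm_mul_radialPower {x : E} (hx : x ≠ 0) :
    ‖x‖ ^ 2 * radialPower (a + 2) q x = radialPower a q x := by
  have h := norm_pos_iff.2 hx
  have h1 : ‖x‖ ^ 2 * ‖x‖ ^ (-(a + 2)) = ‖x‖ ^ (-a) := by
    rw [← Real.rpow_natCast, ← Real.rpow_add h]
    norm_num
  rw [radialPower, radialPower, ← mul_assoc, h1]

theorem continuousOn_radialPower (hq : Continuous q) :
    ContinuousOn (radialPower a q : E → ℝ) {0}ᶜ := by
  intro x hx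
  have h0 : ‖x‖ ≠ 0 := norm_ne_zero_iff.2 hx
  unfold radialPower
  refine ContinuousAt.continuousWithinAt (ContinuousAt.mul ?_ ?_)
  · exact continuous_norm.continuousAt.rpow_const (Or.inl h0)
  · exact hq.continuousAt.comp (continuous_norm.continuousAt.log h0)

variable [InnerProductSpace ℝ E]

/-- Differentiation stays in the same class: up to the factor `⟨x, e⟩`, it raises `a` by `2` and
sends `q` to `q' - a q`. Iterating it yields second derivatives. -/
theorem hasLineDerivAt_radialPower (hq : ∀ s, HasDerivAt q (q' s) s) {x : E} (hx : x ≠ 0) (e : E) :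
    HasLineDerivAt ℝ (radialPower a q)
      (inner ℝ x e * radialPower (a + 2) (fun s => q' s - a * q s) x) x e := by
  have h := norm_pos_iff.2 hx
  have h1 : HasDerivAt (fun t : ℝ => x + t • e) e 0 := by
    simpa using ((hasDerivAt_id (0 : ℝ)).smul_const e).const_add x
  have h2 : HasDerivAt (fun t : ℝ => ‖x + t • e‖) (inner ℝ x e / ‖x‖) 0 := by
    have h3 := h1.norm_sq.sqrt (by simpa using hx)
    simp only [Real.sqrt_sq (norm_nonneg _), zero_smul, add_zero] at h3
    refine h3.congr_deriv ?_
    field_simp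
  have h3 : HasDerivAt (fun t : ℝ => ‖x + t • e‖ ^ (-a))
      (inner ℝ x e / ‖x‖ * -a * ‖x‖ ^ (-a - 1)) 0 := by
    simpa using h2.rpow_const (p := -a) (Or.inl (by simpa using hx))
  have h4 : HasDerivAt (fun t : ℝ => Real.log ‖x + t • e‖) (inner ℝ x e / ‖x‖ / ‖x‖) 0 := by
    simpa using h2.log (by simpa using hx)
  have h5 : HasDerivAt (fun t : ℝ => q (Real.log ‖x + t • e‖))
      (q' (Real.log ‖x‖) * (inner ℝ x e / ‖x‖ / ‖x‖)) 0 := by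
    have := hq (Real.log ‖x + (0 : ℝ) • e‖)
    have := this.comp (0 : ℝ) h4
    simpa [Function.comp_def] using this
  have h6 := h3.mul h5
  rw [HasLineDerivAt]
  refine h6.congr_deriv ?_
  simp only [radialPower, zero_smul, add_zero]
  have e1 : ‖x‖ ^ (-a - 1) = ‖x‖ ^ (-(a + 2)) * ‖x‖ := by
    rw [← Real.rpow_add_one h.ne']; ring_nf
  have e2 : ‖x‖ ^ (-a) = ‖x‖ ^ (-(a + 2)) * ‖x‖ ^ 2 := by
    rw [← Real.rpow_natCast, ← Real.rpow_add h]; norm_num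
  rw [e1, e2]
  field_simp
  ring

variable [FiniteDimensional ℝ E] [MeasurableSpace E] [BorelSpace E] (μ : Measure E)
  [μ.IsAddHaarMeasure]

/-- A function continuous off the origin and `O(‖x‖^(-a))` on bounded sets with `a < dim E` is
locally integrable. -/
theorem locallyIntegrable_of_le_rpow [Nontrivial E] {f : E → ℝ} (hf : ContinuousOn f {0}ᶜ)
    (ha : a < Module.finrank ℝ E)
    (hb : ∀ R, ∃ C, ∀ x, x ≠ 0 → ‖x‖ ≤ R → |f x| ≤ C * ‖x‖ ^ (-a)) : LocallyIntegrable f μ := by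
  have hae : ∀ᵐ x ∂μ, x ≠ 0 := by
    simp [ae_iff]
  have hm : AEStronglyMeasurable f μ := by
    have h1 : AEStronglyMeasurable f (μ.restrict {0}ᶜ) :=
      hf.aestronglyMeasurable (measurableSet_singleton 0).compl
    rwa [restrict_compl_singleton] at h1
  rw [locallyIntegrable_iff]
  intro K hK
  obtain ⟨R, hR0, hR⟩ : ∃ R > 0, K ⊆ Metric.ball (0 : E) R :=
    hK.isBounded.subset_ball_lt 0 0
  obtain ⟨C, hC⟩ := hb R
  refine IntegrableOn.mono_set ?_ hR
  have hint : IntegrableOn (fun x : E => ‖x‖ ^ (-a)) (Metric.ball (0 : E) R) μ := by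
    rw [integrableOn_fun_norm_addHaar μ (f := fun r => r ^ (-a))]
    have h1 := (intervalIntegral.integrableOn_Ioo_rpow_iff
      (s := (Module.finrank ℝ E - 1 : ℝ) + -a) hR0).2 (by linarith)
    refine h1.congr_fun (fun r hr => ?_) measurableSet_Ioo
    have hd : 1 ≤ Module.finrank ℝ E := Module.finrank_pos
    simp only [smul_eq_mul]
    rw [Real.rpow_add hr.1, ← Nat.cast_one, ← Nat.cast_sub hd, Real.rpow_natCast]
  refine (hint.const_mul C).mono' hm.restrict ?_
  filter_upwards [ae_restrict_mem Metric.isOpen_ball.measurableSet, ae_restrict_of_ae hae]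
    with x hx hx0
  exact hC x hx0 (by simpa using (mem_ball_zero_iff.1 hx).le)

/-- By Cauchy–Schwarz each factor `⟨x, e⟩` gains one power of `‖x‖`, offsetting the larger exponents
of derivatives. -/
theorem locallyIntegrable_inner_pow_mul_radialPower [Nontrivial E] (hq : Continuous q)
    (hb : ∀ S, ∃ C, ∀ s ≤ S, |q s| ≤ C) (e : E) (j : ℕ) (ha : a - j < Module.finrank ℝ E) :
    LocallyIntegrable (fun x : E => inner ℝ x e ^ j * radialPower a q x) μ := by
  refine locallyIntegrable_of_le_rpow μ (a := a - j) ?_ ha fun R => ?_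
  · exact (Continuous.continuousOn (by fun_prop)).mul (continuousOn_radialPower hq)
  · obtain ⟨C, hC⟩ := hb (Real.log R)
    refine ⟨‖e‖ ^ j * C, fun x hx hxR => ?_⟩
    have h := norm_pos_iff.2 hx
    have h1 : |q (Real.log ‖x‖)| ≤ C := hC _ (Real.log_le_log h hxR)
    have h2 : |inner ℝ x e| ^ j ≤ (‖x‖ * ‖e‖) ^ j := by
      gcongr
      exact abs_real_inner_le_norm x e
    have h3 : ‖x‖ ^ (-(a - j)) = ‖x‖ ^ j * ‖x‖ ^ (-a) := by
      rw [← Real.rpow_natCast, ← Real.rpow_add h]; ring_nf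
    rw [radialPower, abs_mul, abs_mul, abs_pow, abs_of_nonneg (Real.rpow_nonneg h.le (-a)), h3]
    calc |inner ℝ x e| ^ j * (‖x‖ ^ (-a) * |q (Real.log ‖x‖)|)
        ≤ (‖x‖ * ‖e‖) ^ j * (‖x‖ ^ (-a) * C) := by gcongr
      _ = _ := by ring

theorem locallyIntegrable_radialPower [Nontrivial E] (hq : Continuous q)
    (hb : ∀ S, ∃ C, ∀ s ≤ S, |q s| ≤ C) (ha : a < Module.finrank ℝ E) :
    LocallyIntegrable (radialPower a q : E → ℝ) μ := by
  simpa using locallyIntegrable_inner_pow_mul_radialPower μ hq hb 0 0 (by simpa using ha)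

end RadialFunctions

/-! ### Integration by parts across a point singularity -/

section LineDerivative

variable {E : Type*} [NormedAddCommGroup E] [NormedSpace ℝ E] [FiniteDimensional ℝ E]
  [MeasurableSpace E] [BorelSpace E] (μ : Measure E) [μ.IsAddHaarMeasure]

/-- The integral of a directional derivative vanishes, also when the function is singular at a
point, provided both the function and its derivative are integrable and the dimension is at
least two. -/
theorem integral_lineDeriv_eq_zero (hE : 2 ≤ Module.finrank ℝ E) {f f' : E → ℝ} {e : E}
    (hd : ∀ x, x ≠ 0 → HasLineDerivAt ℝ f (f' x) x e) (hc : ContinuousOn f' {0}ᶜ)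
    (hf : Integrable f μ) (hf' : Integrable f' μ) : ∫ x, f' x ∂μ = 0 := by
  have hline : ∀ᵐ x ∂μ, x ∉ Submodule.span ℝ {e} := by
    -- In dimension at least two the span of `e` is null, and for `x` outside it the line `x + ℝ e`
    -- misses the origin.
    have htop : Submodule.span ℝ {e} ≠ ⊤ := by
      intro h
      have h1 := finrank_span_le_card (R := ℝ) ({e} : Set E)
      rw [h, finrank_top] at h1
      simp at h1
      omega
    have := Measure.addHaar_submodule μ _ htop
    rw [ae_iff]
    simpa using this
  have hftc : ∀ᵐ x ∂μ, ∫ s in (0 : ℝ)..1, f' (x + s • e) = f (x + e) - f x := by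
    filter_upwards [hline] with x hx
    have hne : ∀ s : ℝ, x + s • e ≠ 0 := by
      intro s h0
      apply hx
      rw [eq_neg_of_add_eq_zero_left h0]
      exact Submodule.neg_mem _ (Submodule.smul_mem _ _ (Submodule.mem_span_singleton_self e))
    have hder : ∀ s : ℝ, HasDerivAt (fun s : ℝ => f (x + s • e)) (f' (x + s • e)) s := by
      intro s
      have h1 : HasDerivAt (fun t : ℝ => f (x + s • e + t • e)) (f' (x + s • e)) (-s + s) := by
        rw [neg_add_cancel]
        exact hd _ (hne s)
      have h2 := h1.comp_const_add (-s) s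
      refine h2.congr_of_eventuallyEq (Eventually.of_forall fun t => ?_)
      simp only [add_assoc, ← add_smul]
      congr 3
      ring
    have hcont : Continuous fun s : ℝ => f' (x + s • e) :=
      hc.comp_continuous (by fun_prop) fun s => hne s
    rw [intervalIntegral.integral_eq_sub_of_hasDerivAt (f := fun s : ℝ => f (x + s • e))
      (fun s _ => hder s) (hcont.intervalIntegrable _ _)]
    simp
  have hzero : ∫ x, (∫ s in (0 : ℝ)..1, f' (x + s • e)) ∂μ = 0 := by
    rw [integral_congr_ae hftc, integral_sub (hf.comp_add_right e) hf,
      integral_add_right_eq_self, sub_self]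
  -- The shear preserves the product measure, so Fubini applies and translation invariance turns the
  -- averaged integral into `∫ f'`.
  have hmp : MeasurePreserving (fun p : ℝ × E => (p.1, p.2 + p.1 • e))
      ((volume.restrict (Ioc (0 : ℝ) 1)).prod μ) ((volume.restrict (Ioc (0 : ℝ) 1)).prod μ) := by
    refine (MeasurePreserving.id _).skew_product (g := fun s x => x + s • e) ?_ ?_
    · exact Continuous.measurable (by fun_prop)
    · exact Eventually.of_forall fun s => map_add_right_eq_self μ (s • e)
  have hint : Integrable (Function.uncurry fun (s : ℝ) (x : E) => f' (x + s • e))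
      ((volume.restrict (Ioc (0 : ℝ) 1)).prod μ) :=
    hmp.integrable_comp_of_integrable (hf'.comp_snd (volume.restrict (Ioc (0 : ℝ) 1)))
  have hswap := integral_integral_swap hint
  simp only [integral_add_right_eq_self] at hswap
  simp only [intervalIntegral.integral_of_le zero_le_one] at hzero
  rw [hzero] at hswap
  simpa using hswap

end LineDerivative

/-! ### From orbits to distributional solutions -/

section Stationary

variable {N : ℕ} {α θ : ℝ} {w v : ℝ → ℝ}

/-- An orbit whose components are bounded on left half-lines gives a stationary solution through
the Emden–Fowler change of variables. -/
theorem IsOrbit.isStationarySolution (hα : 0 < α) (hθ : θ * α = 2) (hθN : θ + 2 < N)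
    (h : IsOrbit α (θ * (N - 2 - θ)) (2 * θ - (N - 2)) w v)
    (hw : ∀ S, ∃ C, ∀ s ≤ S, |w s| ≤ C) (hv : ∀ S, ∃ C, ∀ s ≤ S, |v s| ≤ C) :
    IsStationarySolution α (radialPower θ w : EuclideanSpace ℝ (Fin N) → ℝ) := by
  have hθ0 : 0 < θ := pos_of_mul_pos_left (by linarith) hα.le
  have hN2 : 2 < N := by
    have : (2 : ℝ) < N := by linarith
    exact_mod_cast this
  have : Nontrivial (EuclideanSpace ℝ (Fin N)) :=
    Module.nontrivial_of_finrank_pos (R := ℝ) (by rw [finrank_euclideanSpace_fin]; omega)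
  set V := EuclideanSpace ℝ (Fin N)
  have hfr : (Module.finrank ℝ V : ℝ) = N := by rw [finrank_euclideanSpace_fin]
  -- the nonlinearity and the profiles of the first and second derivatives
  let g : ℝ → ℝ := fun s => |w s| ^ α * w s
  let p : ℝ → ℝ := fun s => v s - θ * w s
  let p' : ℝ → ℝ := fun s =>
    ((2 * θ - (N - 2)) * v s + (θ * (N - 2 - θ)) * w s - |w s| ^ α * w s) - θ * v s
  let r : ℝ → ℝ := fun s => p' s - (θ + 2) * p s
  have hwc := h.continuous_fst
  have hvc := h.continuous_snd
  have hgc : Continuous g := (hwc.abs.rpow_const fun _ => Or.inr hα.le).mul hwc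
  have hpc : Continuous p := by fun_prop
  have hrc : Continuous r := by
    have : r = fun s => ((2 * θ - (N - 2)) * v s + (θ * (N - 2 - θ)) * w s - g s) - θ * v s -
      (θ + 2) * p s := rfl
    rw [this]
    fun_prop
  have hgb : ∀ S, ∃ C, ∀ s ≤ S, |g s| ≤ C := by
    intro S
    obtain ⟨C, hC⟩ := hw S
    refine ⟨C ^ α * C, fun s hs => ?_⟩
    have h1 := hC s hs
    have h2 := (abs_nonneg _).trans h1
    simp only [g, abs_mul, Real.abs_rpow_of_nonneg (abs_nonneg _), abs_abs]
    gcongr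
  have hcomb : ∀ {q₁ q₂ : ℝ → ℝ} (c₁ c₂ : ℝ), (∀ S, ∃ C, ∀ s ≤ S, |q₁ s| ≤ C) →
      (∀ S, ∃ C, ∀ s ≤ S, |q₂ s| ≤ C) → ∀ S, ∃ C, ∀ s ≤ S, |c₁ * q₁ s + c₂ * q₂ s| ≤ C := by
    intro q₁ q₂ c₁ c₂ h₁ h₂ S
    obtain ⟨C₁, hC₁⟩ := h₁ S
    obtain ⟨C₂, hC₂⟩ := h₂ S
    refine ⟨|c₁| * C₁ + |c₂| * C₂, fun s hs => (abs_add_le _ _).trans ?_⟩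
    rw [abs_mul, abs_mul]
    gcongr
    · exact hC₁ s hs
    · exact hC₂ s hs
  have hpb : ∀ S, ∃ C, ∀ s ≤ S, |p s| ≤ C := by
    have := hcomb 1 (-θ) hv hw
    refine fun S => (this S).imp fun C hC s hs => (le_of_eq ?_).trans (hC s hs)
    congr 1
    simp only [p]
    ring
  have hrb : ∀ S, ∃ C, ∀ s ≤ S, |r s| ≤ C := by
    have := hcomb 1 (-1) (hcomb (θ - (N - 2)) (θ * (N - 2 - θ)) hv hw)
      (hcomb 1 (θ + 2) hgb hpb)
    refine fun S => (this S).imp fun C hC s hs => (le_of_eq ?_).trans (hC s hs)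
    congr 1
    simp only [r, p', p, g]
    ring
  have hpd : ∀ s, HasDerivAt p (p' s) s := fun s =>
    (h.hasDerivAt_snd s).sub ((h.hasDerivAt_fst s).const_mul θ)
  have hnl : ∀ x : V, x ≠ 0 →
      |radialPower θ w x| ^ α * radialPower θ w x = radialPower (θ + 2) g x := by
    intro x hx
    have hx0 := norm_pos_iff.2 hx
    simp only [radialPower, g]
    rw [abs_mul, abs_of_pos (Real.rpow_pos_of_pos hx0 _),
      Real.mul_rpow (Real.rpow_nonneg hx0.le _) (abs_nonneg _), ← Real.rpow_mul hx0.le,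
      show -(θ + 2) = -θ * α + -θ by linarith, Real.rpow_add hx0]
    ring
  have hae : ∀ᵐ x : V, x ≠ 0 := by simp [ae_iff]
  have hUi : LocallyIntegrable (radialPower θ w : V → ℝ) :=
    locallyIntegrable_radialPower volume hwc hw (by rw [hfr]; linarith)
  have hgi : LocallyIntegrable (radialPower (θ + 2) g : V → ℝ) :=
    locallyIntegrable_radialPower volume hgc hgb (by rw [hfr]; linarith)
  have hpi : LocallyIntegrable (radialPower (θ + 2) p : V → ℝ) :=
    locallyIntegrable_radialPower volume hpc hpb (by rw [hfr]; linarith)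
  refine ⟨hUi, ?_, fun φ hφ hφc => ?_⟩
  · intro x
    obtain ⟨s, hs, hi⟩ := hgi x
    refine ⟨s, hs, hi.congr ?_⟩
    filter_upwards [ae_restrict_of_ae hae] with y hy using (hnl y hy).symm
  · let B := EuclideanSpace.basisFun (Fin N) ℝ
    have hd1 : ∀ e : V, ContDiff ℝ ∞ fun x => fderiv ℝ φ x e := fun e =>
      (hφ.fderiv_right (m := ∞) (by norm_num)).clm_apply contDiff_const
    have hc1 : ∀ e : V, HasCompactSupport fun x => fderiv ℝ φ x e := fun e =>
      hφc.fderiv_apply ℝ e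
    have hd2 : ∀ e : V, Continuous fun x => fderiv ℝ (fun y => fderiv ℝ φ y e) x e := fun e =>
      (((hd1 e).fderiv_right (m := ∞) (by norm_num)).clm_apply contDiff_const).continuous
    have hc2 : ∀ e : V, HasCompactSupport fun x => fderiv ℝ (fun y => fderiv ℝ φ y e) x e :=
      fun e => (hc1 e).fderiv_apply ℝ e
    have hlap : ∀ x, Δ φ x = ∑ i, fderiv ℝ (fun y => fderiv ℝ φ y (B i)) x (B i) := by
      intro x
      rw [InnerProductSpace.laplacian_eq_iteratedFDeriv_orthonormalBasis φ B]
      refine Finset.sum_congr rfl fun i _ => ?_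
      rw [iteratedFDeriv_two_apply]
      have hdiff : DifferentiableAt ℝ (fderiv ℝ φ) x :=
        (hφ.fderiv_right (m := ∞) (by norm_num)).differentiable (by simp) x
      rw [fderiv_clm_apply hdiff (differentiableAt_const _)]
      simp
    -- the difference of the two sides of Green's formula in the direction `e`
    let F : V → V → ℝ := fun e x =>
      radialPower θ w x * fderiv ℝ (fun y => fderiv ℝ φ y e) x e -
        (inner ℝ e e * radialPower (θ + 2) p x + inner ℝ x e ^ 2 * radialPower (θ + 4) r x) * φ x
    have hsi : ∀ e : V, LocallyIntegrable
        (fun x : V => inner ℝ x e ^ 2 * radialPower (θ + 4) r x) := fun e =>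
      locallyIntegrable_inner_pow_mul_radialPower volume hrc hrb e 2
        (by rw [hfr]; push_cast; linarith)
    have hFi : ∀ e, Integrable (F e) := by
      intro e
      have i1 := hUi.integrable_smul_right_of_hasCompactSupport (hd2 e) (hc2 e)
      have i2 := ((hpi.smul (inner ℝ e e : ℝ)).add (hsi e)).integrable_smul_right_of_hasCompactSupport
        hφ.continuous hφc
      exact i1.sub i2
    have hF0 : ∀ e, ∫ x, F e x = 0 := by
      intro e
      -- The field is `U ∂ₑφ - (∂ₑU) φ`. In its derivative the products `∂ₑU ∂ₑφ` cancel, leaving `U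
      -- ∂ₑ²φ - (∂ₑ²U) φ`, whose singularity at `0` is of order `θ + 2 < N`.
      refine integral_lineDeriv_eq_zero volume (by rw [finrank_euclideanSpace_fin]; omega)
        (f := fun x => radialPower θ w x * fderiv ℝ φ x e -
          inner ℝ x e * radialPower (θ + 2) p x * φ x) (e := e) (fun x hx => ?_) ?_ ?_ (hFi e)
      · have l1 := hasLineDerivAt_radialPower (a := θ) h.hasDerivAt_fst hx e
        have l2 := hasLineDerivAt_radialPower (a := θ + 2) hpd hx e
        have l3 : HasLineDerivAt ℝ (fun x => fderiv ℝ φ x e)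
            (fderiv ℝ (fun y => fderiv ℝ φ y e) x e) x e :=
          (((hd1 e).differentiable (by simp)) x).hasFDerivAt.hasLineDerivAt e
        have l4 : HasLineDerivAt ℝ φ (fderiv ℝ φ x e) x e :=
          ((hφ.differentiable (by simp)) x).hasFDerivAt.hasLineDerivAt e
        have l5 : HasLineDerivAt ℝ (fun x : V => inner ℝ x e) (inner ℝ e e) x e := by
          rw [HasLineDerivAt]
          simp only [inner_add_left, inner_smul_left]
          simpa using ((hasDerivAt_id (0 : ℝ)).mul_const (inner ℝ e e : ℝ)).const_add (inner ℝ x e : ℝ)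
        rw [HasLineDerivAt] at l1 l2 l3 l4 l5 ⊢
        refine ((l1.mul l3).sub ((l5.mul l2).mul l4)).congr_deriv ?_
        simp only [Pi.mul_apply, zero_smul, add_zero, F, r, p, show θ + 2 + 2 = θ + 4 by ring]
        ring
      · have c1 := continuousOn_radialPower (E := V) (a := θ) hwc
        have c2 := continuousOn_radialPower (E := V) (a := θ + 2) hpc
        have c3 := continuousOn_radialPower (E := V) (a := θ + 4) hrc
        have c4 : Continuous fun x : V => inner ℝ x e ^ 2 := by fun_prop
        exact (c1.mul (hd2 e).continuousOn).sub
          (((c2.const_smul (inner ℝ e e : ℝ)).add (c4.continuousOn.mul c3)).mul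
            hφ.continuous.continuousOn)
      · have i1 := hUi.integrable_smul_right_of_hasCompactSupport (hd1 e).continuous (hc1 e)
        have hli := locallyIntegrable_inner_pow_mul_radialPower (a := θ + 2) (volume : Measure V)
          hpc hpb e 1 (by rw [hfr]; push_cast; linarith)
        have i2 := hli.integrable_smul_right_of_hasCompactSupport hφ.continuous hφc
        simp only [pow_one, smul_eq_mul] at i1 i2
        exact i1.sub i2
    have hsum : ∀ᵐ x : V, radialPower θ w x * Δ φ x +
        |radialPower θ w x| ^ α * radialPower θ w x * φ x = ∑ i, F (B i) x := by
      filter_upwards [hae] with x hx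
      have hB1 : ∀ i, inner ℝ (B i) (B i) = (1 : ℝ) := fun i => by
        rw [real_inner_self_eq_norm_sq, B.orthonormal.1 i, one_pow]
      have hB2 : ∑ i, inner ℝ x (B i) ^ 2 = ‖x‖ ^ 2 := by
        rw [← B.sum_sq_norm_inner_right x]
        refine Finset.sum_congr rfl fun i _ => ?_
        rw [real_inner_comm, Real.norm_eq_abs, sq_abs]
      simp only [F, Finset.sum_sub_distrib, ← Finset.mul_sum, ← Finset.sum_mul,
        Finset.sum_add_distrib, hB1, hB2, ← hlap, one_mul]
      -- Summing over the basis, `ΔU` has profile `N p + r`, which the ODE identifies with `-g`.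
      rw [hnl x hx, show θ + 4 = θ + 2 + 2 by ring, sq_norm_mul_radialPower hx]
      simp only [Finset.sum_const, Finset.card_univ, Fintype.card_fin, nsmul_eq_mul, radialPower,
        r, p, p', g]
      ring
    rw [integral_congr_ae hsum, integral_finsetSum _ fun i _ => hFi _]
    exact Finset.sum_eq_zero fun i _ => hF0 _

end Stationary

/-! ### The Emden–Fowler flow and the choice of initial data -/

section EmdenFowlerFlow

variable {α β b : ℝ}

theorem hasDerivAt_abs_rpow_mul_self (hα : 0 < α) (x : ℝ) :
    HasDerivAt (fun x : ℝ => |x| ^ α * x) ((α + 1) * |x| ^ α) x := by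
  rcases eq_or_ne x 0 with rfl | hx
  · rw [hasDerivAt_iff_tendsto_slope_zero]
    have h1 : Tendsto (fun t : ℝ => |t| ^ α) (𝓝[≠] 0) (𝓝 (|0| ^ α)) :=
      ((continuous_abs.rpow_const fun _ => Or.inr hα.le).tendsto 0).mono_left nhdsWithin_le_nhds
    simp only [abs_zero, Real.zero_rpow hα.ne', mul_zero] at h1 ⊢
    refine h1.congr' ?_
    filter_upwards [self_mem_nhdsWithin] with t ht
    have ht0 : t ≠ 0 := ht
    simp only [zero_add, sub_zero, smul_eq_mul]
    field_simp
  · have hx' : |x| ≠ 0 := abs_ne_zero.2 hx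
    have h1 := ((hasDerivAt_abs hx).rpow_const (p := α) (Or.inl hx')).mul (hasDerivAt_id x)
    refine h1.congr_deriv ?_
    simp only [id]
    have h2 : |x| ^ (α - 1) * |x| = |x| ^ α := by
      rw [← Real.rpow_add_one hx', sub_add_cancel]
    have h3 : (SignType.sign x : ℝ) * x = |x| := sign_mul_self x
    calc (SignType.sign x : ℝ) * α * |x| ^ (α - 1) * x + |x| ^ α * 1
        = α * (|x| ^ (α - 1) * ((SignType.sign x : ℝ) * x)) + |x| ^ α := by ring
      _ = _ := by rw [h3, h2]; ring

theorem contDiff_abs_rpow_mul_self (hα : 0 < α) : ContDiff ℝ 1 fun x : ℝ => |x| ^ α * x := by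
  rw [contDiff_one_iff_deriv]
  refine ⟨fun x => (hasDerivAt_abs_rpow_mul_self hα x).differentiableAt, ?_⟩
  rw [funext fun x => (hasDerivAt_abs_rpow_mul_self hα x).deriv]
  exact continuous_const.mul (continuous_abs.rpow_const fun _ => Or.inr hα.le)

/-- The flow of the Emden–Fowler system is globally defined and continuous. -/
theorem exists_orbit_flow (hα : 0 < α) (hβ : 0 < β) (hb : 0 < b) :
    ∃ W : (ℝ × ℝ) × ℝ → ℝ × ℝ, Continuous W ∧ ∀ z, W (z, 0) = z ∧
      IsOrbit α β b (fun s => (W (z, s)).1) (fun s => (W (z, s)).2) := by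
  let X : ℝ × ℝ → ℝ × ℝ := fun z => (z.2, b * z.2 + β * z.1 - |z.1| ^ α * z.1)
  -- Twice the potential is added so that the superlinear terms cancel in `H' (X z)`, leaving a
  -- quadratic form.
  let H : ℝ × ℝ → ℝ := fun z => z.1 ^ 2 + z.2 ^ 2 + 2 * (|z.1| ^ (α + 2) / (α + 2))
  let H' : ℝ × ℝ → ℝ × ℝ →L[ℝ] ℝ := fun z =>
    (2 * z.1 + 2 * (|z.1| ^ α * z.1)) • ContinuousLinearMap.fst ℝ ℝ ℝ +
      (2 * z.2) • ContinuousLinearMap.snd ℝ ℝ ℝ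
  have hX : ContDiff ℝ 1 X :=
    contDiff_snd.prodMk (((contDiff_const.mul contDiff_snd).add (contDiff_const.mul contDiff_fst)).sub
      ((contDiff_abs_rpow_mul_self hα).comp contDiff_fst))
  have hH : ∀ z, HasFDerivAt H (H' z) z := by
    intro z
    have h1 : HasDerivAt (fun x : ℝ => x ^ 2 + 2 * (|x| ^ (α + 2) / (α + 2)))
        (2 * z.1 + 2 * (|z.1| ^ α * z.1)) z.1 := by
      refine ((hasDerivAt_pow 2 z.1).fun_add
        ((hasDerivAt_abs_rpow_div hα z.1).const_mul 2)).congr_deriv ?_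
      norm_num
    have h2 : HasDerivAt (fun x : ℝ => x ^ 2) (2 * z.2) z.2 := by
      simpa using hasDerivAt_pow 2 z.2
    have h3 := (h1.comp_hasFDerivAt z (hasFDerivAt_fst (𝕜 := ℝ) (E := ℝ) (F := ℝ))).add
      (h2.comp_hasFDerivAt z (hasFDerivAt_snd (𝕜 := ℝ) (E := ℝ) (F := ℝ)))
    refine h3.congr_of_eventuallyEq (Eventually.of_forall fun y => ?_)
    simp only [H, Pi.add_apply, Function.comp_apply]
    ring
  have hpot : ∀ x : ℝ, 0 ≤ |x| ^ (α + 2) / (α + 2) := fun x => by positivity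
  have hnorm : ∀ z, ‖z‖ ^ 2 ≤ H z := by
    intro z
    have h1 := hpot z.1
    have h2 : ‖z‖ ^ 2 ≤ z.1 ^ 2 + z.2 ^ 2 := by
      rw [Prod.norm_def, ← sq_abs z.1, ← sq_abs z.2]
      simp only [Real.norm_eq_abs]
      rcases max_cases |z.1| |z.2| with h | h <;> rw [h.1] <;> nlinarith [sq_nonneg |z.1|, sq_nonneg |z.2|]
    simp only [H]
    linarith
  have hgrowth : ∀ z, |H' z (X z)| ≤ (1 + β + 2 * b) * H z := by
    intro z
    have h1 := hpot z.1
    have h2 : H' z (X z) = 2 * (1 + β) * (z.1 * z.2) + 2 * b * z.2 ^ 2 := by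
      simp only [H', X, add_apply, smul_apply,
        ContinuousLinearMap.coe_fst', ContinuousLinearMap.coe_snd', smul_eq_mul]
      ring
    have h3 : z.1 ^ 2 + z.2 ^ 2 ≤ H z := by simp only [H]; linarith
    have h4 : |H' z (X z)| ≤ (1 + β + 2 * b) * (z.1 ^ 2 + z.2 ^ 2) := by
      rw [h2, abs_le]
      have e1 : 0 ≤ (1 + β) * (z.1 + z.2) ^ 2 := by positivity
      have e2 : 0 ≤ (1 + β) * (z.1 - z.2) ^ 2 := by positivity
      have e3 : 0 ≤ b * z.1 ^ 2 := by positivity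
      have e4 : 0 ≤ b * z.2 ^ 2 := by positivity
      constructor <;> nlinarith
    refine h4.trans ?_
    gcongr
  obtain ⟨W, hWc, hW⟩ := exists_global_flow hX hH hnorm hgrowth
  refine ⟨W, hWc, fun z => ⟨(hW z).1, fun s => ?_, fun s => ?_⟩⟩
  · exact hasFDerivAt_fst.comp_hasDerivAt s ((hW z).2 s)
  · exact hasFDerivAt_snd.comp_hasDerivAt s ((hW z).2 s)

/-- There is an open ball of initial data of orbits that come out of the right-hand well of the
energy and have positive energy at time `1`. -/
theorem exists_ball_initial_data (hα : 0 < α) (hβ : 0 < β) (hb : 0 < b)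
    {W : (ℝ × ℝ) × ℝ → ℝ × ℝ} (hWc : Continuous W) (hW : ∀ z, W (z, 0) = z ∧
      IsOrbit α β b (fun s => (W (z, s)).1) (fun s => (W (z, s)).2)) :
    ∃ z₀ : ℝ × ℝ, ∃ ε > 0, ∀ z ∈ Metric.ball z₀ ε, 0 < z.1 ∧ energy α β z.1 z.2 < 0 ∧
      0 < energy α β (W (z, 1)).1 (W (z, 1)).2 := by
  set A := zeroEnergyAmplitude α β with hA
  have hA0 : 0 < A := zeroEnergyAmplitude_pos hα hβ
  have hEc : Continuous fun z : ℝ × ℝ => energy α β z.1 z.2 := continuous_energy hα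
  have hE1 : Continuous fun z : ℝ × ℝ => energy α β (W (z, 1)).1 (W (z, 1)).2 :=
    hEc.comp (hWc.comp (by fun_prop))
  have hO : IsOpen {z : ℝ × ℝ | 0 < z.1 ∧ energy α β z.1 z.2 < 0 ∧
      0 < energy α β (W (z, 1)).1 (W (z, 1)).2} :=
    (isOpen_lt continuous_const continuous_fst).inter
      ((isOpen_lt hEc continuous_const).inter (isOpen_lt continuous_const hE1))
  have hpos : 0 < energy α β (W ((A, 0), 1)).1 (W ((A, 0), 1)).2 :=
    (hW (A, 0)).2.energy_one_pos hα hβ hb (congrArg Prod.fst (hW (A, 0)).1)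
      (congrArg Prod.snd (hW (A, 0)).1)
  have hline : Continuous fun x : ℝ => energy α β (W ((x, 0), 1)).1 (W ((x, 0), 1)).2 :=
    hE1.comp (by fun_prop : Continuous fun x : ℝ => ((x, 0) : ℝ × ℝ))
  -- Approaching `A` from the left keeps positive energy at time `1` and makes the initial energy
  -- negative.
  have hev : ∀ᶠ x in 𝓝[<] A, 0 < energy α β (W ((x, 0), 1)).1 (W ((x, 0), 1)).2 :=
    nhdsWithin_le_nhds (continuousAt_const.eventually_lt hline.continuousAt hpos)
  obtain ⟨x, hx1, hx⟩ := (hev.and (Ioo_mem_nhdsLT hA0)).exists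
  have hneg : energy α β x 0 < 0 := by
    rw [energy_eq hα, abs_of_pos hx.1]
    have h1 : x ^ α < A ^ α := Real.rpow_lt_rpow hx.1.le hx.2 hα
    rw [hA, zeroEnergyAmplitude_rpow hα hβ] at h1
    have h2 : x ^ α / (α + 2) < β / 2 := by
      rw [div_lt_iff₀ (by linarith)]; linarith
    have h3 : 0 < x ^ 2 * (β / 2 - x ^ α / (α + 2)) :=
      mul_pos (pow_pos hx.1 2) (by linarith)
    linarith
  obtain ⟨ε, hε, hsub⟩ := Metric.isOpen_iff.1 hO (x, 0) ⟨hx.1, hneg, hx1⟩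
  exact ⟨(x, 0), ε, hε, fun z hz => hsub hz⟩

end EmdenFowlerFlow

/-! ### Parametrising the ball of initial data -/

section InitialData

/-- An embedding of the open quadrant of the plane into a ball. -/
noncomputable def initialData (z₀ : ℝ × ℝ) (ε : ℝ) (p : ℝ × ℝ) : ℝ × ℝ :=
  z₀ + (ε * (p.1 / (1 + p.1)), ε * (p.2 / (1 + p.2)))

variable {z₀ : ℝ × ℝ} {ε : ℝ}

theorem initialData_mem_ball (hε : 0 < ε) {p : ℝ × ℝ} (h₁ : 0 < p.1) (h₂ : 0 < p.2) :
    initialData z₀ ε p ∈ Metric.ball z₀ ε := by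
  have key : ∀ t : ℝ, 0 < t → |ε * (t / (1 + t))| < ε := by
    intro t ht
    rw [abs_of_pos (by positivity)]
    have : t / (1 + t) < 1 := by rw [div_lt_one (by positivity)]; linarith
    nlinarith
  rw [mem_ball_iff_norm, initialData, add_sub_cancel_left, Prod.norm_def]
  exact max_lt (key _ h₁) (key _ h₂)

theorem initialData_injOn (hε : 0 < ε) : InjOn (initialData z₀ ε) (Ioi 0 ×ˢ Ioi 0) := by
  have key : ∀ s t : ℝ, 0 < s → 0 < t → ε * (s / (1 + s)) = ε * (t / (1 + t)) → s = t := by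
    intro s t hs ht h
    have h1 := mul_left_cancel₀ hε.ne' h
    rw [div_eq_div_iff (by positivity) (by positivity)] at h1
    linarith
  intro p hp q hq h
  have h1 := add_left_cancel h
  rw [Prod.mk.injEq] at h1
  exact Prod.ext (key _ _ hp.1 hq.1 h1.1) (key _ _ hp.2 hq.2 h1.2)

theorem continuousOn_initialData : ContinuousOn (initialData z₀ ε) (Ioi 0 ×ˢ Ioi 0) := by
  have h1 : ∀ p ∈ Ioi (0 : ℝ) ×ˢ Ioi (0 : ℝ), 1 + p.1 ≠ 0 := fun p hp => by
    have : 0 < p.1 := hp.1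
    positivity
  have h2 : ∀ p ∈ Ioi (0 : ℝ) ×ˢ Ioi (0 : ℝ), 1 + p.2 ≠ 0 := fun p hp => by
    have : 0 < p.2 := hp.2
    positivity
  refine continuousOn_const.add (ContinuousOn.prodMk ?_ ?_)
  · exact continuousOn_const.mul (continuousOn_fst.div (by fun_prop) h1)
  · exact continuousOn_const.mul (continuousOn_snd.div (by fun_prop) h2)

theorem parameterSet_subset (α : ℝ) : parameterSet α ⊆ Ioi 0 ×ˢ Ioi 0 :=
  prod_mono le_rfl Ioo_subset_Ioi_self

end InitialData

/-! ### Properties of `U` read off from its profile -/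

section OrbitSolutions

variable {E : Type*} [NormedAddCommGroup E] {α β b θ : ℝ} {w v : ℝ → ℝ}

theorem IsOrbit.contDiff_fst (hα : 0 < α) (h : IsOrbit α β b w v) : ContDiff ℝ 2 w := by
  have hv : ContDiff ℝ 1 v := by
    rw [contDiff_one_iff_deriv]
    refine ⟨fun s => (h.hasDerivAt_snd s).differentiableAt, ?_⟩
    rw [funext fun s => (h.hasDerivAt_snd s).deriv]
    have h1 := h.continuous_fst
    have h2 := h.continuous_snd
    have h3 : Continuous fun s => |w s| ^ α := h1.abs.rpow_const fun _ => Or.inr hα.le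
    fun_prop
  rw [show (2 : ℕ∞ω) = 1 + 1 by norm_num, contDiff_succ_iff_deriv]
  refine ⟨fun s => (h.hasDerivAt_fst s).differentiableAt, by simp, ?_⟩
  rwa [funext fun s => (h.hasDerivAt_fst s).deriv]

theorem contDiffOn_radialPower [InnerProductSpace ℝ E] {n : ℕ∞ω} {q : ℝ → ℝ} (hq : ContDiff ℝ n q) :
    ContDiffOn ℝ n (radialPower θ q : E → ℝ) {0}ᶜ := by
  intro x hx
  have hx' : x ≠ 0 := hx
  have h0 : ‖x‖ ≠ 0 := norm_ne_zero_iff.2 hx'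
  have h1 : ContDiffAt ℝ n (fun x : E => ‖x‖) x := contDiffAt_norm ℝ hx'
  exact ((h1.rpow_const_of_ne h0).mul (hq.contDiffAt.comp x (h1.log h0))).contDiffWithinAt

theorem abs_radialPower {q : ℝ → ℝ} (x : E) :
    |radialPower θ q x| = ‖x‖ ^ (-θ) * |q (Real.log ‖x‖)| := by
  rw [radialPower, abs_mul, abs_of_nonneg (Real.rpow_nonneg (norm_nonneg x) _)]

theorem isRadial_radialPower {N : ℕ} {q : ℝ → ℝ} :
    IsRadial (radialPower θ q : EuclideanSpace ℝ (Fin N) → ℝ) :=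
  ⟨fun r => r ^ (-θ) * q (Real.log r), fun _ _ => rfl⟩

theorem isSingularAtZero_radialPower {N : ℕ} {q : ℝ → ℝ} (hθ : 0 < θ) {m : ℝ} (hm : 0 < m)
    (hq : ∀ s ≤ 0, m ≤ q s) :
    IsSingularAtZero (radialPower θ q : EuclideanSpace ℝ (Fin N) → ℝ) := by
  have h1 : Tendsto (fun x : EuclideanSpace ℝ (Fin N) => ‖x‖ ^ (-θ) * m) (𝓝[≠] 0) atTop :=
    ((tendsto_rpow_neg_nhdsGT_zero (neg_lt_zero.2 hθ)).comp tendsto_norm_nhdsNE_zero).atTop_mul_const hm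
  refine tendsto_atTop_mono' _ ?_ h1
  have hball : Metric.ball (0 : EuclideanSpace ℝ (Fin N)) 1 ∈ 𝓝[≠] 0 :=
    nhdsWithin_le_nhds (Metric.ball_mem_nhds 0 one_pos)
  filter_upwards [hball] with x hx
  have h2 : ‖x‖ < 1 := mem_ball_zero_iff.1 hx
  rw [abs_radialPower]
  gcongr
  exact (hq _ (Real.log_nonpos (norm_nonneg x) h2.le)).trans (le_abs_self _)

theorem oscillatesAtInfinity_radialPower {N : ℕ} (hN : 0 < N) {q : ℝ → ℝ}
    (h₁ : ∀ S, ∃ s > S, 0 < q s) (h₂ : ∀ S, ∃ s > S, q s < 0) :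
    OscillatesAtInfinity (radialPower θ q : EuclideanSpace ℝ (Fin N) → ℝ) := by
  let e : EuclideanSpace ℝ (Fin N) := EuclideanSpace.single ⟨0, hN⟩ 1
  have hnorm : ∀ s : ℝ, ‖Real.exp s • e‖ = Real.exp s := by
    intro s
    simp [e, norm_smul]
  have hval : ∀ s : ℝ, radialPower θ q (Real.exp s • e) = Real.exp s ^ (-θ) * q s := by
    intro s
    rw [radialPower, hnorm, Real.log_exp]
  have hfar : ∀ R s : ℝ, Real.log (max R 1) < s → R < ‖Real.exp s • e‖ := by
    intro R s hs
    rw [hnorm]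
    exact (le_max_left R 1).trans_lt ((Real.log_lt_iff_lt_exp (by positivity)).1 hs)
  intro R
  obtain ⟨s, hs, hqs⟩ := h₁ (Real.log (max R 1))
  obtain ⟨t, ht, hqt⟩ := h₂ (Real.log (max R 1))
  refine ⟨⟨_, hfar R s hs, ?_⟩, ⟨_, hfar R t ht, ?_⟩⟩
  · rw [hval]
    positivity
  · rw [hval]
    exact mul_neg_of_pos_of_neg (by positivity) hqt

theorem OscillatesAtInfinity.isSignChanging {N : ℕ} {U : EuclideanSpace ℝ (Fin N) → ℝ}
    (h : OscillatesAtInfinity U) : IsSignChanging U := by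
  obtain ⟨⟨x, hx, hUx⟩, ⟨y, hy, hUy⟩⟩ := h 0
  exact ⟨⟨x, norm_pos_iff.1 hx, hUx⟩, ⟨y, norm_pos_iff.1 hy, hUy⟩⟩

/-- The power `|U|^r` is again a radial power, with exponent `θ r` and profile `|q|^r`. -/
theorem memLqLoc_radialPower {N : ℕ} (hN : 0 < N) {q : ℝ → ℝ} {r : ℝ} (hr : 0 < r)
    (hθr : θ * r < N) (hq : Continuous q) (hb : ∀ S, ∃ C, ∀ s ≤ S, |q s| ≤ C) :
    MemLqLoc r (radialPower θ q : EuclideanSpace ℝ (Fin N) → ℝ) := by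
  have : Nontrivial (EuclideanSpace ℝ (Fin N)) :=
    Module.nontrivial_of_finrank_pos (R := ℝ) (by rwa [finrank_euclideanSpace_fin])
  have hae : ∀ᵐ x : EuclideanSpace ℝ (Fin N), x ≠ 0 := by simp [ae_iff]
  intro K hK
  have hm : AEStronglyMeasurable (radialPower θ q : EuclideanSpace ℝ (Fin N) → ℝ) volume := by
    have h1 := (continuousOn_radialPower (E := EuclideanSpace ℝ (Fin N)) (a := θ)
      hq).aestronglyMeasurable (μ := volume) (measurableSet_singleton 0).compl
    rwa [restrict_compl_singleton] at h1
  rw [← integrable_norm_rpow_iff hm.restrict (by simpa using hr) ENNReal.ofReal_ne_top,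
    ENNReal.toReal_ofReal hr.le]
  have hli : LocallyIntegrable
      (radialPower (θ * r) (fun s => |q s| ^ r) : EuclideanSpace ℝ (Fin N) → ℝ) := by
    refine locallyIntegrable_radialPower volume (hq.abs.rpow_const fun _ => Or.inr hr.le)
      (fun S => ?_) (by rwa [finrank_euclideanSpace_fin])
    obtain ⟨C, hC⟩ := hb S
    refine ⟨C ^ r, fun s hs => ?_⟩
    rw [abs_of_nonneg (by positivity)]
    exact Real.rpow_le_rpow (abs_nonneg _) (hC s hs) hr.le
  refine (hli.integrableOn_isCompact hK).congr ?_
  filter_upwards with x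
  have hx := norm_nonneg x
  rw [Real.norm_eq_abs, abs_radialPower, Real.mul_rpow (Real.rpow_nonneg hx _) (abs_nonneg _),
    ← Real.rpow_mul hx, radialPower, neg_mul]

theorem abs_radialPower_le_of_growth {q : ℝ → ℝ} {C : ℝ}
    (hq : ∀ s, 0 ≤ s → |q s| ≤ C * Real.exp (b * s)) (x : E) (hx : 1 < ‖x‖) :
    |radialPower θ q x| ≤ C * ‖x‖ ^ (b - θ) := by
  have h0 : 0 < ‖x‖ := by linarith
  have h1 := hq _ (Real.log_nonneg hx.le)
  rw [mul_comm b, ← Real.rpow_def_of_pos h0] at h1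
  rw [abs_radialPower]
  calc ‖x‖ ^ (-θ) * |q (Real.log ‖x‖)| ≤ ‖x‖ ^ (-θ) * (C * ‖x‖ ^ b) := by gcongr
    _ = C * (‖x‖ ^ b * ‖x‖ ^ (-θ)) := by ring
    _ = _ := by rw [← Real.rpow_add h0, sub_eq_add_neg]

/-- Radial functions `‖x‖^(-θ) q(log ‖x‖)` that agree off the origin have the same profile. -/
theorem eq_of_radialPower_eq {N : ℕ} (hN : 0 < N) {q₁ q₂ : ℝ → ℝ}
    (h : ∀ x : EuclideanSpace ℝ (Fin N), x ≠ 0 → radialPower θ q₁ x = radialPower θ q₂ x) :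
    q₁ = q₂ := by
  funext s
  let e : EuclideanSpace ℝ (Fin N) := EuclideanSpace.single ⟨0, hN⟩ 1
  have hnorm : ‖Real.exp s • e‖ = Real.exp s := by
    simp [e, norm_smul]
  have h1 := h (Real.exp s • e) (norm_pos_iff.1 (by rw [hnorm]; positivity))
  rw [radialPower, radialPower, hnorm, Real.log_exp] at h1
  exact mul_left_cancel₀ (by positivity) h1

end OrbitSolutions

end NLHE

/-! ### Assembly of the two-parameter family -/

open NLHE

/-- The two-parameter family is a map `p ↦ U p` on an open rectangle of the plane which is injective
(distinct parameters give functions that differ on `ℝ^N ∖ {0}`) and continuous (jointly in the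
parameter and in `x ≠ 0`). -/
theorem corollary6p2 (N : ℕ) (hN : 3 ≤ N) (α : ℝ)
    (hα₁ : 2 / ((N : ℝ) - 2) < α) (hα₂ : α < 4 / ((N : ℝ) - 2)) :
    ∃ U : ℝ × ℝ → EuclideanSpace ℝ (Fin N) → ℝ,
      (∀ p ∈ NLHE.parameterSet α, ∀ q ∈ NLHE.parameterSet α, p ≠ q →
        ∃ x, x ≠ 0 ∧ U p x ≠ U q x) ∧
      ContinuousOn (fun z : (ℝ × ℝ) × EuclideanSpace ℝ (Fin N) => U z.1 z.2)
        (NLHE.parameterSet α ×ˢ {0}ᶜ) ∧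
      ∀ p ∈ NLHE.parameterSet α,
        ContDiffOn ℝ 2 (U p) {0}ᶜ ∧
        NLHE.MemLqLoc (α + 1) (U p) ∧
        NLHE.IsStationarySolution α (U p) ∧
        NLHE.IsRadial (U p) ∧
        NLHE.IsSignChanging (U p) ∧
        NLHE.IsSingularAtZero (U p) ∧
        (∃ C : ℝ, ∀ x : EuclideanSpace ℝ (Fin N), 1 < ‖x‖ →
          |U p x| ≤ C * ‖x‖ ^ (-((N : ℝ) - 2 - 2 / α))) ∧
        NLHE.OscillatesAtInfinity (U p) := by
  have hN0 : 0 < N := by omega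
  have hN2 : (0 : ℝ) < N - 2 := by
    have : (3 : ℝ) ≤ N := by exact_mod_cast hN
    linarith
  have hα : 0 < α := (by positivity : (0 : ℝ) < 2 / ((N : ℝ) - 2)).trans hα₁
  obtain ⟨θ, hθ⟩ : ∃ θ, θ = 2 / α := ⟨_, rfl⟩
  have hθα : θ * α = 2 := by rw [hθ, div_mul_cancel₀ _ hα.ne']
  have hθ0 : 0 < θ := by rw [hθ]; positivity
  have hθN : θ < N - 2 := by
    rw [div_lt_iff₀ hN2] at hα₁
    rw [hθ, div_lt_iff₀ hα]
    linarith
  have hb : 0 < 2 * θ - ((N : ℝ) - 2) := by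
    rw [lt_div_iff₀ hN2] at hα₂
    have : ((N : ℝ) - 2) / 2 < θ := by
      rw [hθ, lt_div_iff₀ hα]
      linarith
    linarith
  have hβ : 0 < θ * ((N : ℝ) - 2 - θ) := mul_pos hθ0 (by linarith)
  obtain ⟨W, hWc, hW⟩ := exists_orbit_flow hα hβ hb
  obtain ⟨z₀, ε, hε, hz₀⟩ := exists_ball_initial_data hα hβ hb hWc hW
  have hquad := parameterSet_subset α
  refine ⟨fun p => radialPower θ fun s => (W (initialData z₀ ε p, s)).1, ?_, ?_, ?_⟩
  · intro p hp q hq hpq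
    by_contra! heq
    apply hpq
    have hw := eq_of_radialPower_eq hN0 heq
    -- The second component is the derivative of the first, so equal profiles give equal initial
    -- data.
    have hv : (fun s => (W (initialData z₀ ε p, s)).2) = fun s => (W (initialData z₀ ε q, s)).2 := by
      funext s
      have h1 := (hW (initialData z₀ ε p)).2.hasDerivAt_fst s
      rw [hw] at h1
      exact h1.unique ((hW (initialData z₀ ε q)).2.hasDerivAt_fst s)
    have h0 : W (initialData z₀ ε p, 0) = W (initialData z₀ ε q, 0) :=
      Prod.ext (congrFun hw 0) (congrFun hv 0)
    rw [(hW _).1, (hW _).1] at h0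
    exact initialData_injOn hε (hquad hp) (hquad hq) h0
  · have hne : ∀ z ∈ parameterSet α ×ˢ ({0}ᶜ : Set (EuclideanSpace ℝ (Fin N))), ‖z.2‖ ≠ 0 :=
      fun z hz => norm_ne_zero_iff.2 hz.2
    have hnorm : ContinuousOn (fun z : (ℝ × ℝ) × EuclideanSpace ℝ (Fin N) => ‖z.2‖)
        (parameterSet α ×ˢ {0}ᶜ) := continuousOn_snd.norm
    have hinit : ContinuousOn (fun z : (ℝ × ℝ) × EuclideanSpace ℝ (Fin N) => initialData z₀ ε z.1)
        (parameterSet α ×ˢ {0}ᶜ) :=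
      continuousOn_initialData.comp continuousOn_fst fun z hz => hquad hz.1
    exact (hnorm.rpow_const fun z hz => Or.inl (hne z hz)).mul
      ((continuous_fst.comp hWc).comp_continuousOn (hinit.prodMk (hnorm.log hne)))
  · intro p hp
    obtain ⟨hw0, hE0, hE1⟩ := hz₀ _ (initialData_mem_ball hε (hquad hp).1 (hquad hp).2)
    have horb := (hW (initialData z₀ ε p)).2
    have hinit := (hW (initialData z₀ ε p)).1
    set w := fun s => (W (initialData z₀ ε p, s)).1 with hw
    set v := fun s => (W (initialData z₀ ε p, s)).2 with hv
    obtain ⟨m, hm, C, hC⟩ := horb.exists_backward_bound hα hβ hb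
      (by simpa only [hw, hv, hinit] using hE0) (by simpa only [hw, hinit] using hw0)
    have hbdd : ∀ {q : ℝ → ℝ}, Continuous q → (∀ s ≤ 0, |q s| ≤ C) →
        ∀ S, ∃ C, ∀ s ≤ S, |q s| ≤ C := by
      intro q hq hqC S
      obtain ⟨D, hD⟩ := (isCompact_Icc (a := (0 : ℝ)) (b := S)).exists_bound_of_continuousOn
        hq.continuousOn
      refine ⟨max C D, fun s hs => ?_⟩
      rcases le_total s 0 with h | h
      · exact (hqC s h).trans (le_max_left _ _)
      · exact (hD s ⟨h, hs⟩).trans (le_max_right _ _)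
    have hwb := hbdd horb.continuous_fst fun s hs =>
      abs_le.2 ⟨by linarith [(hC s hs).1, (hC s hs).2.1], (hC s hs).2.1⟩
    have hvb := hbdd horb.continuous_snd fun s hs => (hC s hs).2.2
    have hosc : OscillatesAtInfinity (radialPower θ w : EuclideanSpace ℝ (Fin N) → ℝ) :=
      oscillatesAtInfinity_radialPower hN0 (horb.exists_pos hα hβ hb hE1)
        (horb.exists_neg hα hβ hb hE1)
    obtain ⟨D, hD⟩ := horb.exists_forward_bound hα hβ hb
    -- The integrability condition is `θ (α + 1) = θ + 2 < N`.
    refine ⟨contDiffOn_radialPower (horb.contDiff_fst hα),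
      memLqLoc_radialPower hN0 (by linarith) (by linarith) horb.continuous_fst hwb,
      horb.isStationarySolution hα hθα (by linarith) hwb hvb, isRadial_radialPower,
      hosc.isSignChanging, isSingularAtZero_radialPower hθ0 hm fun s hs => (hC s hs).1,
      ⟨D, fun x hx => ?_⟩, hosc⟩
    have h1 := abs_radialPower_le_of_growth (θ := θ) hD x hx
    rwa [show 2 * θ - ((N : ℝ) - 2) - θ = -((N : ℝ) - 2 - 2 / α) by rw [← hθ]; ring] at h1
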